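/- Let $\Gamma$ be a countable group with a left-invariant distance $d$ that is proper (all balls are finite); write $|g|=d(g,e)$ and $B(e,n)=\{g:|g|\le n\}$. Assume that $v=\liminf_n \frac1n\log\#B(e,n)$ is finite. Let $\mu$ be a symmetric probability measure on $\Gamma$ (that is, $\mu(g^{-1})=\mu(g)$) with finite second moment, and put $M_2=M_2(\mu)=\bigl(\sum_g|g|^2\mu(g)\bigr)^{1/2}<\infty$. Denote by $\mu^{*n}$ the $n$-fold convolution of $\mu$ and by $\rho=\limsup_n\mu^{*n}(e)^{1/n}$ the spectral radius. Then the drift $\ell=\lim_n\frac1n\sum_g|g|\,\mu^{*n}(g)$ exists and is finite. Put $\tilde\ell=\ell/M_2$ (read as $0$ if $M_2=0$, i.e. if $\mu=\delta_e$) and $\tilde v=M_2 v$. Then $$\tilde\ell\le\tanh(\tilde v/2),\qquad \rho\ge\frac1{\cosh(\tilde v/2)}.$$ If moreover $H(\mu)=-\sum_g\mu(g)\log\mu(g)$ is finite, or if the balls grow at most exponentially (there is $C$ with $\#B(e,n)\le e^{Cn}$ for all $n\ge1$), then $H(\mu^{*n})=-\sum_g\mu^{*n}(g)\log\mu^{*n}(g)$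 is finite for every $n$, the asymptotic entropy $h=\lim_n\frac1n H(\mu^{*n})$ exists and is finite, and $$h\le\tilde v\,\tanh(\tilde v/2).$$ -/

import Mathlib

namespace RandomWalk

noncomputable section

open Filter Topology

/-- The law `μ^{*n}` of `X_n = γ₁ ⋯ γ_n`, where the `γ_i` are independent with law `μ`. -/
def convPow {Γ : Type*} [Group Γ] (μ : PMF Γ) : ℕ → PMF Γ
  | 0 => PMF.pure 1
  | n + 1 => (convPow μ n).bind fun x => μ.map fun y => x * y

/-- `μ` is symmetric. -/
def IsSymmetric {Γ : Type*} [Group Γ] (μ : PMF Γ) : Prop :=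
  ∀ g : Γ, μ g⁻¹ = μ g

/-- The distance is proper: all balls around the identity are finite. -/
def ProperDist (Γ : Type*) [Group Γ] [MetricSpace Γ] : Prop :=
  ∀ r : ℝ, (Metric.closedBall (1 : Γ) r).Finite

/-- The exponential growth rate `v = liminf (1/n) log #B(e,n)`, with values in `[0, ∞]`. -/
def volumeGrowth (Γ : Type*) [Group Γ] [MetricSpace Γ] : EReal :=
  liminf (fun n : ℕ =>
    ((Real.log ((Metric.closedBall (1 : Γ) (n : ℝ)).ncard : ℝ) / (n : ℝ) : ℝ) : EReal)) atTop

/-- The cardinality of the balls `B(e,n)` grows at most exponentially. -/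
def AtMostExponentialGrowth (Γ : Type*) [Group Γ] [MetricSpace Γ] : Prop :=
  ∃ C : ℝ, ∀ n : ℕ, 1 ≤ n →
    ((Metric.closedBall (1 : Γ) (n : ℝ)).ncard : ℝ) ≤ Real.exp (C * (n : ℝ))

/-- `μ` has a finite second moment. -/
def FiniteSecondMoment {Γ : Type*} [Group Γ] [MetricSpace Γ] (μ : PMF Γ) : Prop :=
  Summable fun g : Γ => dist g 1 ^ 2 * (μ g).toReal

/-- `M₂(μ) = (∑_g |g|² μ(g))^{1/2}`. -/
def M₂ {Γ : Type*} [Group Γ] [MetricSpace Γ] (μ : PMF Γ) : ℝ :=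
  Real.sqrt (∑' g : Γ, dist g 1 ^ 2 * (μ g).toReal)

/-- `H(μ) = -∑_g μ(g) log μ(g)` is finite (all terms are nonnegative). -/
def FiniteEntropy {Γ : Type*} (μ : PMF Γ) : Prop :=
  Summable fun g : Γ => Real.negMulLog (μ g).toReal

/-- `ℓ` is the drift of the walk: every `∑_g |g| μ^{*n}(g)` is finite, and
`ℓ = lim (1/n) ∑_g |g| μ^{*n}(g)`. -/
def IsDrift {Γ : Type*} [Group Γ] [MetricSpace Γ] (μ : PMF Γ) (ℓ : ℝ) : Prop :=
  (∀ n : ℕ, Summable fun g : Γ => dist g 1 * (convPow μ n g).toReal) ∧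
  Tendsto (fun n : ℕ => (∑' g : Γ, dist g 1 * (convPow μ n g).toReal) / (n : ℝ)) atTop (𝓝 ℓ)

/-- `h` is the asymptotic entropy of the walk: every `H(μ^{*n})` is finite, and
`h = lim (1/n) H(μ^{*n})`. -/
def IsAsymptoticEntropy {Γ : Type*} [Group Γ] (μ : PMF Γ) (h : ℝ) : Prop :=
  (∀ n : ℕ, FiniteEntropy (convPow μ n)) ∧
  Tendsto (fun n : ℕ => (∑' g : Γ, Real.negMulLog (convPow μ n g).toReal) / (n : ℝ))
    atTop (𝓝 h)

/-- The spectral radius `ρ = limsup (μ^{*n}(e))^{1/n}`, a limsup of numbers in `[0, 1]`. -/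
def spectralRadius {Γ : Type*} [Group Γ] (μ : PMF Γ) : ℝ :=
  limsup (fun n : ℕ => (convPow μ n 1).toReal ^ (1 / (n : ℝ))) atTop

end

end RandomWalk

namespace RandomWalk

noncomputable section

open Filter Topology

/-! Drift. Let p_k be the law of the walk at time k and q_n the law at time n plus an independent
geometric time. The density u = (p_0 + ... + p_{n-1} + q_n)/(n+1) is almost stationary: one step of
the walk changes it by exactly (q_n - δ_e)/(n+1) (`hasSum_increment_occupation`). Test this identity
against two functions. Against |x| it gives at least nℓ/(n+1). Against -log u it gives at most about
log #B(e,ℓn)/n, hence vℓ along suitable n, because q_n ≤ (n+1)u and the walk concentrates in balls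
of radius (ℓ+ε)n (`exists_tail_convPow_le`).

By symmetry of μ both quantities are sums over edges (x, xγ) of (u(x)-u(xγ))(F(xγ)-F(x))/2
(`hasSum_parts`), and they can be compared edge by edge. With t half the difference of log u along
the edge, the entropy term is (u(x)+u(xγ)) t tanh t and the length term is at most (u(x)+u(xγ))
|tanh t| |γ| / 2. Convexity of y ↦ √y artanh √y and a completed square give `edge_production`.
Summed over edges, where only the second moment of |γ| enters, this is `drift_inequality`; letting τ
decrease to M₂v/2 yields ℓ/M₂ ≤ tanh(M₂v/2). Truncating u from below at a tiny κ makes the sums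
converge without any entropy assumption.

Entropy. The bound is h ≤ ℓv (`asymptoticEntropy_le_drift_mul`) combined with the drift bound.

Spectral radius. Rayleigh quotients bound ρ from below (`rayleigh_le_spectralRadius`). For f =
e^{-t|x|} cut off at a large ball, with t > v/2, an edge of length g inside the ball has f(x)f(xγ)
at least 1/cosh(tg) times the mean of the two squares, and the boundary is negligible
(`testFun_edge`). Convexity of y ↦ 1/cosh √y then leaves only the second moment. -/

/-! ### Weights of probability mass functions -/

/-- The real-valued weight of a probability mass function. -/
def wt {α : Type*} (a : PMF α) (x : α) : ℝ := (a x).toReal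

section Weights

variable {α : Type*}

lemma wt_nonneg (a : PMF α) (x : α) : 0 ≤ wt a x := ENNReal.toReal_nonneg

lemma hasSum_wt (a : PMF α) : HasSum (wt a) 1 := by
  have h := (ENNReal.summable_toReal a.tsum_coe_ne_top).hasSum
  rwa [← ENNReal.tsum_toReal_eq a.apply_ne_top, a.tsum_coe, ENNReal.toReal_one] at h

lemma summable_wt (a : PMF α) : Summable (wt a) := (hasSum_wt a).summable

lemma wt_le_one (a : PMF α) (x : α) : wt a x ≤ 1 :=
  ENNReal.toReal_le_of_le_ofReal zero_le_one (by simpa using a.coe_le_one x)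

lemma hasSum_of_eq {f g : α → ℝ} {s t : ℝ} (h : HasSum f s) (hfg : ∀ x, g x = f x)
    (hst : t = s) : HasSum g t := by
  rw [hst, show g = f from funext hfg]
  exact h

lemma hasSum_mul_prod {β : Type*} {f : α → ℝ} {g : β → ℝ} {s t : ℝ}
    (hf : HasSum f s) (hg : HasSum g t) :
    HasSum (fun p : α × β => f p.1 * g p.2) (s * t) :=
  hf.mul hg (summable_mul_of_summable_norm hf.summable.norm hg.summable.norm)

/-- A bounded function is summable against `a`. -/
lemma summable_wt_mul_of_abs_le (a : PMF α) {F : α → ℝ} {C : ℝ} (hF : ∀ x, |F x| ≤ C) :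
    Summable fun x => wt a x * F x := by
  refine Summable.of_norm_bounded ((summable_wt a).mul_right C) fun x => ?_
  rw [Real.norm_eq_abs, abs_mul, abs_of_nonneg (wt_nonneg a x)]
  exact mul_le_mul_of_nonneg_left (hF x) (wt_nonneg a x)

/-- Monotonicity of expectations, including summability, for nonnegative functions. -/
lemma summable_wt_mul_of_le (a : PMF α) {F G : α → ℝ} (hF : ∀ x, 0 ≤ F x)
    (hFG : ∀ x, 0 < wt a x → F x ≤ G x) (hG : Summable fun x => wt a x * G x) :
    (Summable fun x => wt a x * F x) ∧ ∑' x, wt a x * F x ≤ ∑' x, wt a x * G x := by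
  have hle : ∀ x, wt a x * F x ≤ wt a x * G x := fun x => by
    rcases (wt_nonneg a x).eq_or_lt with h | h
    · simp [← h]
    · exact mul_le_mul_of_nonneg_left (hFG x h) h.le
  have hs := Summable.of_nonneg_of_le (fun x => mul_nonneg (wt_nonneg a x) (hF x)) hle hG
  exact ⟨hs, hs.tsum_le_tsum hle hG⟩

end Weights

/-! ### Convolution -/

section Convolution

variable {Γ : Type*} [Group Γ]

/-- The convolution of two probability mass functions on a group. -/
def mulConv (a b : PMF Γ) : PMF Γ := a.bind fun x => b.map fun y => x * y

lemma mulConv_apply (a b : PMF Γ) (z : Γ) : mulConv a b z = ∑' x, a x * b (x⁻¹ * z) := by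
  classical
  rw [mulConv, PMF.bind_apply]
  refine tsum_congr fun x => ?_
  rw [PMF.map_apply, tsum_eq_single (x⁻¹ * z)]
  · simp
  · intro y hy
    rw [if_neg]
    rintro rfl
    simp at hy

lemma wt_mulConv (a b : PMF Γ) (z : Γ) :
    wt (mulConv a b) z = ∑' x, wt a x * wt b (x⁻¹ * z) := by
  rw [wt, mulConv_apply, ENNReal.tsum_toReal_eq
    fun x => ENNReal.mul_ne_top (a.apply_ne_top x) (b.apply_ne_top _)]
  simp [wt]

lemma summable_wt_mulConv (a b : PMF Γ) (z : Γ) :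
    Summable fun x => wt a x * wt b (x⁻¹ * z) :=
  Summable.of_nonneg_of_le (fun _ => mul_nonneg (wt_nonneg a _) (wt_nonneg b _))
    (fun x => mul_le_of_le_one_right (wt_nonneg a x) (wt_le_one b _)) (summable_wt a)

/-- A single term of the convolution sum. After taking logarithms it makes the information function
-log subadditive along products. -/
lemma mul_wt_le_wt_mulConv (a b : PMF Γ) (x y : Γ) :
    wt a x * wt b y ≤ wt (mulConv a b) (x * y) := by
  rw [wt_mulConv]
  have := (summable_wt_mulConv a b (x * y)).le_tsum x
    fun _ _ => mul_nonneg (wt_nonneg a _) (wt_nonneg b _)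
  simpa using this

/-- The change of variables `(z, x) ↦ (x, x⁻¹ z)` on `Γ × Γ`. -/
def factorEquiv (Γ : Type*) [Group Γ] : Γ × Γ ≃ Γ × Γ where
  toFun p := (p.2, p.2⁻¹ * p.1)
  invFun p := (p.1 * p.2, p.1)
  left_inv p := by simp
  right_inv p := by simp

/-- Expectations against a convolution are double sums. -/
lemma hasSum_mulConv (a b : PMF Γ) {F : Γ → ℝ} {s : ℝ}
    (h : HasSum (fun p : Γ × Γ => wt a p.1 * wt b p.2 * F (p.1 * p.2)) s) :
    HasSum (fun z => wt (mulConv a b) z * F z) s := by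
  have h' := (factorEquiv Γ).hasSum_iff.2 h
  refine h'.prod_fiberwise fun z => ?_
  have hz := (h'.summable.prod_factor z).hasSum
  have e : wt (mulConv a b) z * F z = ∑' x, ((fun p : Γ × Γ => wt a p.1 * wt b p.2 *
      F (p.1 * p.2)) ∘ factorEquiv Γ) (z, x) := by
    rw [wt_mulConv, ← tsum_mul_right]
    simp [factorEquiv]
  rwa [e]

/-- Upper bounds for expectations of nonnegative functions against a convolution. -/
lemma mulConv_tsum_le (a b : PMF Γ) {F : Γ → ℝ} {Φ : Γ × Γ → ℝ} {s : ℝ}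
    (hF : ∀ x, 0 ≤ F x)
    (hFΦ : ∀ x y, 0 < wt a x → 0 < wt b y → F (x * y) ≤ Φ (x, y))
    (hΦ : HasSum (fun p : Γ × Γ => wt a p.1 * wt b p.2 * Φ p) s) :
    (Summable fun z => wt (mulConv a b) z * F z) ∧
      ∑' z, wt (mulConv a b) z * F z ≤ s := by
  have hle : ∀ p : Γ × Γ, wt a p.1 * wt b p.2 * F (p.1 * p.2) ≤ wt a p.1 * wt b p.2 * Φ p := by
    rintro ⟨x, y⟩
    rcases (wt_nonneg a x).eq_or_lt with hx | hx
    · simp [← hx]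
    rcases (wt_nonneg b y).eq_or_lt with hy | hy
    · simp [← hy]
    exact mul_le_mul_of_nonneg_left (hFΦ x y hx hy) (mul_nonneg hx.le hy.le)
  have hs := Summable.of_nonneg_of_le (fun p : Γ × Γ => mul_nonneg
    (mul_nonneg (wt_nonneg a p.1) (wt_nonneg b p.2)) (hF (p.1 * p.2))) hle hΦ.summable
  have h := hasSum_mulConv a b hs.hasSum
  exact ⟨h.summable, h.tsum_eq ▸ (hs.tsum_le_tsum hle hΦ.summable).trans_eq hΦ.tsum_eq⟩

/-- Subadditive functionals are subadditive under convolution. -/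
lemma mulConv_tsum_le_add (a b : PMF Γ) {F G H : Γ → ℝ} (hF : ∀ x, 0 ≤ F x)
    (hFGH : ∀ x y, 0 < wt a x → 0 < wt b y → F (x * y) ≤ G x + H y)
    (hG : Summable fun x => wt a x * G x) (hH : Summable fun x => wt b x * H x) :
    (Summable fun z => wt (mulConv a b) z * F z) ∧
      ∑' z, wt (mulConv a b) z * F z ≤ ∑' x, wt a x * G x + ∑' x, wt b x * H x := by
  refine mulConv_tsum_le a b (Φ := fun p => G p.1 + H p.2) hF hFGH ?_
  have h1 := hasSum_mul_prod hG.hasSum (hasSum_wt b)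
  have h2 := hasSum_mul_prod (hasSum_wt a) hH.hasSum
  rw [mul_one] at h1
  rw [one_mul] at h2
  convert h1.add h2 using 2 with p
  ring

lemma convPow_succ (μ : PMF Γ) (n : ℕ) : convPow μ (n + 1) = mulConv (convPow μ n) μ := rfl

lemma mulConv_assoc (a b c : PMF Γ) : mulConv (mulConv a b) c = mulConv a (mulConv b c) := by
  simp only [mulConv, PMF.bind_bind, PMF.map_bind, PMF.bind_map, PMF.map_comp]
  congr 1; funext x
  congr 1; funext y
  simp [Function.comp_def, mul_assoc]

lemma mulConv_pure_one (a : PMF Γ) : mulConv a (PMF.pure 1) = a := by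
  simp [mulConv, PMF.pure_map]

lemma pure_one_mulConv (a : PMF Γ) : mulConv (PMF.pure 1) a = a := by
  simp only [mulConv, PMF.pure_bind, one_mul]
  exact PMF.map_id a

lemma convPow_add (μ : PMF Γ) (m n : ℕ) :
    convPow μ (m + n) = mulConv (convPow μ m) (convPow μ n) := by
  induction n with
  | zero => exact (mulConv_pure_one _).symm
  | succ n ih => rw [← add_assoc, convPow_succ, ih, mulConv_assoc, ← convPow_succ]

lemma convPow_mul (μ : PMF Γ) (m k : ℕ) : convPow μ (m * k) = convPow (convPow μ m) k := by
  induction k with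
  | zero => rfl
  | succ k ih => rw [Nat.mul_succ, convPow_add, ih, ← convPow_succ]

lemma convPow_one (μ : PMF Γ) : convPow μ 1 = μ := pure_one_mulConv μ

lemma wt_pure_one (x : Γ) [Decidable (x = 1)] : wt (PMF.pure (1 : Γ)) x = if x = 1 then 1 else 0 := by
  classical
  rw [wt, PMF.pure_apply]
  split_ifs <;> simp

lemma hasSum_wt_pure_one (F : Γ → ℝ) : HasSum (fun x => wt (PMF.pure (1 : Γ)) x * F x) (F 1) := by
  classical
  convert hasSum_ite_eq (1 : Γ) (F 1) using 2 with x
  rw [wt_pure_one]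
  split_ifs with h <;> simp [h]

lemma IsSymmetric.wt_inv {μ : PMF Γ} (h : IsSymmetric μ) (g : Γ) : wt μ g⁻¹ = wt μ g := by
  rw [wt, wt, h g]

end Convolution

/-! ### The length function -/

section Length

variable {Γ : Type*} [Group Γ] [MetricSpace Γ] [IsIsometricSMul Γ Γ]

lemma dist_mul_self_left (x y : Γ) : dist (x * y) x = dist y 1 := by
  simpa using dist_mul_left x y 1

lemma dist_mul_one_le (x y : Γ) : dist (x * y) 1 ≤ dist x 1 + dist y 1 := by
  have := dist_triangle (x * y) x 1
  rw [dist_mul_self_left] at this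
  linarith

lemma abs_dist_mul_sub_le (x y : Γ) : |dist (x * y) 1 - dist x 1| ≤ dist y 1 := by
  rw [← dist_mul_self_left x y]
  exact abs_dist_sub_le _ _ _

end Length

/-! ### Hyperbolic inequalities -/

section Hyperbolic

open Real

lemma hasDerivAt_tanh (t : ℝ) : HasDerivAt tanh (1 / cosh t ^ 2) t := by
  have h := (hasDerivAt_sinh t).div (hasDerivAt_cosh t) (cosh_pos t).ne'
  have e : (fun x => sinh x / cosh x) = tanh := by
    funext x
    rw [tanh_eq_sinh_div_cosh]
  have e' : cosh t * cosh t - sinh t * sinh t = 1 := by nlinarith [cosh_sq t]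
  change HasDerivAt (fun x => sinh x / cosh x) _ t at h
  rwa [e, e'] at h

lemma tanh_pos_of_pos {t : ℝ} (ht : 0 < t) : 0 < tanh t := by
  rw [tanh_eq_sinh_div_cosh]
  exact div_pos (sinh_pos_iff.2 ht) (cosh_pos t)

lemma continuous_tanh_real : Continuous tanh :=
  continuous_iff_continuousAt.2 fun t => (hasDerivAt_tanh t).continuousAt

lemma le_sinh_mul_cosh {t : ℝ} (ht : 0 ≤ t) : t ≤ sinh t * cosh t :=
  (self_le_sinh_iff.2 ht).trans
    (le_mul_of_one_le_right (sinh_nonneg_iff.2 ht) (one_le_cosh t))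

/-- A function which decreases on `[0, c]` and increases on `[c, ∞)` is minimal at `c`. -/
lemma le_of_deriv_sign {g g' : ℝ → ℝ} {c t : ℝ} (hg : ∀ x, HasDerivAt g (g' x) x)
    (hneg : ∀ x, 0 < x → x ≤ c → g' x ≤ 0) (hpos : ∀ x, 0 < c → c ≤ x → 0 ≤ g' x)
    (hc : 0 < c) (ht : 0 ≤ t) : g c ≤ g t := by
  have hcont : Continuous g := continuous_iff_continuousAt.2 fun x => (hg x).continuousAt
  rcases le_total t c with h | h
  · refine antitoneOn_of_deriv_nonpos (convex_Icc 0 c) hcont.continuousOn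
      (fun x _ => (hg x).differentiableAt.differentiableWithinAt) (fun x hx => ?_)
      ⟨ht, h⟩ ⟨hc.le, le_rfl⟩ h
    rw [interior_Icc] at hx
    rw [(hg x).deriv]
    exact hneg x hx.1 hx.2.le
  · refine monotoneOn_of_deriv_nonneg (convex_Ici c) hcont.continuousOn
      (fun x _ => (hg x).differentiableAt.differentiableWithinAt) (fun x hx => ?_)
      (Set.mem_Ici.2 le_rfl) h h
    rw [interior_Ici] at hx
    rw [(hg x).deriv]
    exact hpos x hc (le_of_lt hx)

/-- The function `tanh t / t` decreases on `(0, ∞)`. -/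
lemma mul_tanh_le_mul_tanh {s t : ℝ} (hs : 0 < s) (hst : s ≤ t) : s * tanh t ≤ t * tanh s := by
  have hg : ∀ x, HasDerivAt (fun x => x * tanh s - s * tanh x)
      (1 * tanh s - s * (1 / cosh x ^ 2)) x := fun x =>
    ((hasDerivAt_id x).mul_const _).sub ((hasDerivAt_tanh x).const_mul s)
  have hmono : MonotoneOn (fun x => x * tanh s - s * tanh x) (Set.Ici s) := by
    refine monotoneOn_of_deriv_nonneg (convex_Ici s)
      (fun x _ => (hg x).continuousAt.continuousWithinAt)
      (fun x _ => (hg x).differentiableAt.differentiableWithinAt) fun x hx => ?_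
    rw [interior_Ici] at hx
    rw [(hg x).deriv, tanh_eq_sinh_div_cosh]
    have hx' : s < x := hx
    have hcs := cosh_pos s
    have h1 : cosh s ≤ cosh x := by
      rw [cosh_le_cosh, abs_of_pos hs, abs_of_pos (hs.trans hx')]
      exact hx'.le
    -- The derivative in x is increasing, so it suffices that it is nonnegative at x = s, which is s
    -- ≤ sinh s cosh s.
    have h2 : s * (1 / cosh x ^ 2) ≤ s * (1 / cosh s ^ 2) := by
      gcongr
    have h3 : s * (1 / cosh s ^ 2) ≤ sinh s / cosh s := by
      rw [mul_one_div, div_le_div_iff₀ (by positivity) hcs]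
      nlinarith [le_sinh_mul_cosh hs.le]
    linarith
  have := hmono (Set.mem_Ici.2 le_rfl) hst hst
  simp only at this
  linarith

/-- Convexity of `x ↦ √x artanh √x`, as a tangent inequality. -/
lemma mul_tanh_tangent {t τ : ℝ} (ht : 0 ≤ t) (hτ : 0 < τ) :
    τ * tanh τ + (cosh τ ^ 2 + τ / tanh τ) / 2 * (tanh t ^ 2 - tanh τ ^ 2) ≤ t * tanh t := by
  -- The derivative of t tanh t with respect to tanh² t, taken at t = τ.
  set B := (cosh τ ^ 2 + τ / tanh τ) / 2 with hB
  have hT := tanh_pos_of_pos hτ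
  have hg : ∀ x, HasDerivAt (fun x => x * tanh x - B * tanh x ^ 2)
      (1 * tanh x + x * (1 / cosh x ^ 2) - B * (2 * tanh x ^ (2 - 1) * (1 / cosh x ^ 2))) x :=
    fun x => ((hasDerivAt_id x).mul (hasDerivAt_tanh x)).sub
      (((hasDerivAt_tanh x).pow 2).const_mul B)
  have key : ∀ x, 1 * tanh x + x * (1 / cosh x ^ 2)
      - B * (2 * tanh x ^ (2 - 1) * (1 / cosh x ^ 2)) =
      ((cosh x ^ 2 - cosh τ ^ 2) * tanh x + (x * tanh τ - τ * tanh x) / tanh τ) /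
        cosh x ^ 2 := by
    intro x
    have := (cosh_pos x).ne'
    rw [hB]
    field_simp
    ring
  have hcosh : ∀ {x y : ℝ}, 0 ≤ x → x ≤ y → cosh x ^ 2 ≤ cosh y ^ 2 := fun {x y} hx hxy => by
    have : cosh x ≤ cosh y := by
      rw [cosh_le_cosh, abs_of_nonneg hx, abs_of_nonneg (hx.trans hxy)]
      exact hxy
    have := cosh_pos x
    gcongr
  have := le_of_deriv_sign hg (c := τ) (t := t) ?_ ?_ hτ ht
  · linarith
  · intro x hx hxτ
    rw [key]
    refine div_nonpos_of_nonpos_of_nonneg (add_nonpos ?_ ?_) (by positivity)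
    · exact mul_nonpos_of_nonpos_of_nonneg (by linarith [hcosh hx.le hxτ])
        (tanh_pos_of_pos hx).le
    · exact div_nonpos_of_nonpos_of_nonneg (by linarith [mul_tanh_le_mul_tanh hx hxτ]) hT.le
  · intro x _ hx
    rw [key]
    refine div_nonneg (add_nonneg ?_ ?_) (by positivity)
    · exact mul_nonneg (by linarith [hcosh hτ.le hx]) (tanh_pos_of_pos (hτ.trans_le hx)).le
    · exact div_nonneg (by linarith [mul_tanh_le_mul_tanh hτ hx]) hT.le

/-- Convexity of `x ↦ 1 / cosh √x`, as a tangent inequality. -/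
lemma one_div_cosh_tangent {a b : ℝ} (ha : 0 ≤ a) (hb : 0 < b) :
    1 / cosh b - tanh b / (2 * b * cosh b) * (a ^ 2 - b ^ 2) ≤ 1 / cosh a := by
  -- Minus the derivative of 1/cosh x with respect to x², taken at x = b.
  set k := tanh b / (2 * b * cosh b) with hk
  have hg : ∀ x, HasDerivAt (fun x => 1 / cosh x + k * x ^ 2)
      ((0 * cosh x - 1 * sinh x) / cosh x ^ 2 + k * (2 * x ^ (2 - 1) * 1)) x := fun x =>
    ((hasDerivAt_const x (1 : ℝ)).div (hasDerivAt_cosh x) (cosh_pos x).ne').add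
      (((hasDerivAt_id x).pow 2).const_mul k)
  have key : ∀ x, (0 * cosh x - 1 * sinh x) / cosh x ^ 2 + k * (2 * x ^ (2 - 1) * 1) =
      (x * tanh b / cosh b - b * tanh x / cosh x) / b := by
    intro x
    have := (cosh_pos x).ne'
    have := (cosh_pos b).ne'
    rw [hk, tanh_eq_sinh_div_cosh x]
    field_simp
    ring
  have hcosh : ∀ {x y : ℝ}, 0 ≤ x → x ≤ y → cosh x ≤ cosh y := fun {x y} hx hxy => by
    rw [cosh_le_cosh, abs_of_nonneg hx, abs_of_nonneg (hx.trans hxy)]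
    exact hxy
  have hTb := tanh_pos_of_pos hb
  have := le_of_deriv_sign hg (c := b) (t := a) ?_ ?_ hb ha
  · linarith
  · intro x hx hxb
    rw [key]
    refine div_nonpos_of_nonpos_of_nonneg (sub_nonpos.2 ?_) hb.le
    exact div_le_div₀ (mul_nonneg hb.le (tanh_pos_of_pos hx).le) (mul_tanh_le_mul_tanh hx hxb)
      (cosh_pos x) (hcosh hx.le hxb)
  · intro x _ hx
    rw [key]
    refine div_nonneg (sub_nonneg.2 ?_) hb.le
    exact div_le_div₀ (mul_nonneg (hb.le.trans hx) hTb.le) (mul_tanh_le_mul_tanh hb hx)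
      (cosh_pos b) (hcosh hb.le hx)

/-- The entropy production along an edge of length `g`, bounded below in terms of the
difference of the two endpoint values. -/
lemma edge_production {w w' τ M g : ℝ} (hw : 0 < w) (hw' : 0 < w') (hτ : 0 < τ) (hM : 0 < M) :
    2 * (sinh τ * cosh τ + τ) / M * (|w - w'| / 2) * g
      - (w + w') / 2 * (tanh τ * (sinh τ * cosh τ - τ)
        + tanh τ * (sinh τ * cosh τ + τ) * (g / M) ^ 2) ≤
      (w - w') * (log w - log w') / 2 := by
  wlog hle : w' ≤ w generalizing w w'
  · have := this hw' hw (le_of_not_ge hle)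
    rw [abs_sub_comm] at this
    linarith
  have hT := tanh_pos_of_pos hτ
  set D := sinh τ * cosh τ + τ with hD
  -- With a the geometric mean of w and w', one has w - w' = 2a sinh t and w + w' = 2a cosh t.
  -- Dividing by a cosh t leaves an inequality in tanh t and t tanh t alone.
  set t := (log w - log w') / 2 with ht
  set a := exp ((log w + log w') / 2) with ha
  have ht0 : 0 ≤ t := by have := log_le_log hw' hle; rw [ht]; linarith
  have hwa : w = a * exp t := by
    rw [ha, ht, ← exp_add, ← exp_log hw]; simp; ring_nf
  have hwa' : w' = a * exp (-t) := by
    rw [ha, ht, ← exp_add, ← exp_log hw']; simp; ring_nf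
  have hsub : w - w' = 2 * a * sinh t := by rw [hwa, hwa', sinh_eq]; ring
  have hadd : w + w' = 2 * a * cosh t := by rw [hwa, hwa', cosh_eq]; ring
  have hct := cosh_pos t
  have ha0 : 0 < a := exp_pos _
  have hsinh : sinh t = cosh t * tanh t := by rw [tanh_eq_sinh_div_cosh]; field_simp
  have hlog : log w - log w' = 2 * t := by rw [ht]; ring
  rw [abs_of_nonneg (sub_nonneg.2 hle), hsub, hadd, hlog, hsinh]
  have hBD : (cosh τ ^ 2 + τ / tanh τ) = D / tanh τ := by
    rw [hD, tanh_eq_sinh_div_cosh]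
    have := cosh_pos τ
    have := sinh_pos_iff.2 hτ
    field_simp
  have htan := mul_tanh_tangent ht0 hτ
  rw [hBD] at htan
  have hD0 : 0 < D := add_pos (mul_pos (sinh_pos_iff.2 hτ) (cosh_pos τ)) hτ
  -- The coefficient is the one for which tanh² t cancels against twice the tangent inequality.
  -- Nothing is lost when g = M and t = τ.
  have hsq : 0 ≤ D / tanh τ * (tanh t - tanh τ * (g / M)) ^ 2 := by positivity
  have hmain : 2 * D / M * tanh t * g - (tanh τ * (sinh τ * cosh τ - τ)
      + tanh τ * D * (g / M) ^ 2) ≤ 2 * t * tanh t := by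
    have e1 : D / tanh τ * (tanh t - tanh τ * (g / M)) ^ 2 =
        D / tanh τ * tanh t ^ 2 - 2 * D / M * tanh t * g + tanh τ * D * (g / M) ^ 2 := by
      field_simp
      ring
    have e2 : D / tanh τ / 2 * (tanh t ^ 2 - tanh τ ^ 2) =
        (D / tanh τ * tanh t ^ 2 - D * tanh τ) / 2 := by
      field_simp
    rw [e1] at hsq
    rw [e2] at htan
    have e3 : tanh τ * (sinh τ * cosh τ - τ) = D * tanh τ - 2 * (τ * tanh τ) := by
      rw [hD]; ring
    rw [e3]
    linarith
  have := mul_le_mul_of_nonneg_left hmain (mul_pos ha0 hct).le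
  calc _ = a * cosh t * (2 * D / M * tanh t * g - (tanh τ * (sinh τ * cosh τ - τ)
      + tanh τ * D * (g / M) ^ 2)) := by ring
    _ ≤ _ := this
    _ = _ := by ring

/-- The version of `edge_production` for values truncated from below at `κ`. -/
lemma edge_production_truncated {u u' κ τ M g : ℝ} (hu : 0 ≤ u) (hu' : 0 ≤ u') (hκ : 0 < κ)
    (hτ : 0 < τ) (hM : 0 < M) (hg : 0 ≤ g) :
    2 * (sinh τ * cosh τ + τ) / M * (|u - u'| / 2 - (min u κ + min u' κ) / 2) * g
      - (u + u' + min u κ + min u' κ) / 2 * (tanh τ * (sinh τ * cosh τ - τ)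
        + tanh τ * (sinh τ * cosh τ + τ) * (g / M) ^ 2) ≤
      (u - u') * (log (max u κ) - log (max u' κ)) / 2 := by
  have hT := tanh_pos_of_pos hτ
  have hsc := le_sinh_mul_cosh hτ.le
  have hw : 0 < max u κ := lt_max_of_lt_right hκ
  have hw' : 0 < max u' κ := lt_max_of_lt_right hκ
  have hr : 0 ≤ min u κ := le_min hu hκ.le
  have hr' : 0 ≤ min u' κ := le_min hu' hκ.le
  have hD0 : 0 < sinh τ * cosh τ + τ := by linarith
  have hC : 0 ≤ 2 * (sinh τ * cosh τ + τ) / M := by positivity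
  have hE : 0 ≤ tanh τ * (sinh τ * cosh τ - τ)
      + tanh τ * (sinh τ * cosh τ + τ) * (g / M) ^ 2 := by
    have : 0 ≤ sinh τ * cosh τ - τ := by linarith
    positivity
  have hmm : max u κ = u + κ - min u κ := by linarith [min_add_max u κ]
  have hmm' : max u' κ = u' + κ - min u' κ := by linarith [min_add_max u' κ]
  -- Since u = max u κ + min u κ - κ, truncation changes the difference by at most the sum of the
  -- two minima.
  have habs : |u - u'| / 2 - (min u κ + min u' κ) / 2 ≤ |max u κ - max u' κ| / 2 := by
    have h1 : |u - u'| ≤ |max u κ - max u' κ| + |min u κ - min u' κ| := by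
      have : u - u' = (max u κ - max u' κ) + (min u κ - min u' κ) := by rw [hmm, hmm']; ring
      rw [this]
      exact abs_add_le _ _
    have h2 : |min u κ - min u' κ| ≤ min u κ + min u' κ := by
      rw [abs_le]; constructor <;> linarith
    linarith
  rcases lt_or_ge u κ with h1 | h1
  · rcases lt_or_ge u' κ with h2 | h2
    · rw [max_eq_right h1.le, max_eq_right h2.le, sub_self, mul_zero, zero_div]
      rw [max_eq_right h1.le, max_eq_right h2.le, sub_self, abs_zero, zero_div] at habs
      -- Both values lie below κ: the truncated logarithms agree, so the right side is 0, while the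
      -- correction by the minima makes the left side nonpositive.
      have := mul_nonneg (mul_nonneg hC hg) (neg_nonneg.2 habs)
      have h3 : 0 ≤ (u + u' + min u κ + min u' κ) / 2 := by linarith
      have := mul_nonneg h3 hE
      nlinarith
    · have := edge_production (g := g) hw hw' hτ hM
      rw [max_eq_right h1.le, max_eq_left h2] at this habs ⊢
      rw [min_eq_left h1.le, min_eq_right h2] at habs ⊢
      have hl : log κ ≤ log u' := log_le_log hκ h2
      have a1 := mul_le_mul_of_nonneg_left habs (mul_nonneg hC hg)
      have a2 : (κ + u') / 2 * (tanh τ * (sinh τ * cosh τ - τ)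
        + tanh τ * (sinh τ * cosh τ + τ) * (g / M) ^ 2) ≤ _ :=
        mul_le_mul_of_nonneg_right (show (κ + u') / 2 ≤ (u + u' + u + κ) / 2 by linarith) hE
      -- Both factors are nonpositive, so lowering κ to u in the first one only increases the
      -- product.
      have a3 : (κ - u') * (log κ - log u') ≤ (u - u') * (log κ - log u') := by
        nlinarith
      linarith
  · rcases lt_or_ge u' κ with h2 | h2
    · have := edge_production (g := g) hw hw' hτ hM
      rw [max_eq_left h1, max_eq_right h2.le] at this habs ⊢
      rw [min_eq_right h1, min_eq_left h2.le] at habs ⊢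
      have hl : log κ ≤ log u := log_le_log hκ h1
      have a1 := mul_le_mul_of_nonneg_left habs (mul_nonneg hC hg)
      have a2 : (u + κ) / 2 * (tanh τ * (sinh τ * cosh τ - τ)
        + tanh τ * (sinh τ * cosh τ + τ) * (g / M) ^ 2) ≤ _ :=
        mul_le_mul_of_nonneg_right (show (u + κ) / 2 ≤ (u + u' + κ + u') / 2 by linarith) hE
      have a3 : (u - κ) * (log u - log κ) ≤ (u - u') * (log u - log κ) := by
        nlinarith
      linarith
    · have := edge_production (g := g) hw hw' hτ hM
      rw [max_eq_left h1, max_eq_left h2] at this habs ⊢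
      have a1 := mul_le_mul_of_nonneg_left habs (mul_nonneg hC hg)
      have a2 : (u + u') / 2 * (tanh τ * (sinh τ * cosh τ - τ)
        + tanh τ * (sinh τ * cosh τ + τ) * (g / M) ^ 2) ≤ _ :=
        mul_le_mul_of_nonneg_right
          (show (u + u') / 2 ≤ (u + u' + min u κ + min u' κ) / 2 by linarith) hE
      linarith

end Hyperbolic

/-! ### Moments and the drift -/

section Moments

variable {Γ : Type*} [Group Γ] [MetricSpace Γ]

/-- The mean length of a random element with law `a`. -/
def meanLength (a : PMF Γ) : ℝ := ∑' x, wt a x * dist x 1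

lemma meanLength_nonneg (a : PMF Γ) : 0 ≤ meanLength a :=
  tsum_nonneg fun x => mul_nonneg (wt_nonneg a x) dist_nonneg

lemma FiniteSecondMoment.summable {a : PMF Γ} (h : FiniteSecondMoment a) :
    Summable fun x => wt a x * dist x 1 ^ 2 :=
  h.congr fun _ => mul_comm _ _

lemma FiniteSecondMoment.summable_dist {a : PMF Γ} (h : FiniteSecondMoment a) :
    Summable fun x => wt a x * dist x 1 := by
  refine (summable_wt_mul_of_le a (G := fun x => 1 + dist x 1 ^ 2) (fun _ => dist_nonneg)
    (fun x _ => by nlinarith [sq_nonneg (dist x 1 - 1)]) ?_).1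
  simpa only [mul_add, mul_one] using (summable_wt a).add h.summable

lemma FiniteSecondMoment.hasSum_dist {a : PMF Γ} (h : FiniteSecondMoment a) :
    HasSum (fun x => wt a x * dist x 1) (meanLength a) :=
  h.summable_dist.hasSum

lemma M₂_nonneg (a : PMF Γ) : 0 ≤ M₂ a := Real.sqrt_nonneg _

lemma M₂_sq {a : PMF Γ} : M₂ a ^ 2 = ∑' x, wt a x * dist x 1 ^ 2 := by
  rw [M₂, Real.sq_sqrt (tsum_nonneg fun x => by positivity)]
  exact tsum_congr fun x => mul_comm _ _

lemma hasSum_M₂_sq {a : PMF Γ} (h : FiniteSecondMoment a) :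
    HasSum (fun x => wt a x * dist x 1 ^ 2) (M₂ a ^ 2) :=
  M₂_sq (a := a) ▸ h.summable.hasSum

lemma meanLength_eq_zero_of_M₂_eq_zero {a : PMF Γ} (h : FiniteSecondMoment a) (h0 : M₂ a = 0) :
    meanLength a = 0 := by
  have hs := hasSum_M₂_sq h
  rw [h0, zero_pow two_ne_zero,
    hasSum_zero_iff_of_nonneg fun x => mul_nonneg (wt_nonneg a x) (sq_nonneg _)] at hs
  have : ∀ x, wt a x * dist x 1 = 0 := fun x => by
    have := congrFun hs x
    simpa using this
  simp [meanLength, this]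

lemma bddBelow_meanLength_div (μ : PMF Γ) :
    BddBelow (Set.range fun n : ℕ => meanLength (convPow μ n) / n) :=
  ⟨0, by
    rintro _ ⟨n, rfl⟩
    exact div_nonneg (meanLength_nonneg _) n.cast_nonneg⟩

/-- The second moment of the excess of the length over `α`. -/
def excess (a : PMF Γ) (α : ℝ) : ℝ := ∑' x, wt a x * max (dist x 1 - α) 0 ^ 2

lemma summable_sq_sub {a : PMF Γ} (h : FiniteSecondMoment a) (β : ℝ) :
    Summable fun x => wt a x * (dist x 1 - β) ^ 2 := by
  have h1 := (h.summable.sub (h.summable_dist.mul_right (2 * β))).add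
    ((summable_wt a).mul_right (β ^ 2))
  refine h1.congr fun x => ?_
  ring

lemma summable_excess {a : PMF Γ} (h : FiniteSecondMoment a) (α : ℝ) :
    Summable fun x => wt a x * max (dist x 1 - α) 0 ^ 2 := by
  refine (summable_wt_mul_of_le a (fun x => sq_nonneg _) (fun x _ => ?_) (summable_sq_sub h α)).1
  rcases le_total (dist x 1 - α) 0 with h | h
  · simpa [max_eq_right h] using sq_nonneg _
  · rw [max_eq_left h]

lemma excess_antitone {a : PMF Γ} (h : FiniteSecondMoment a) : Antitone (excess a) :=
  fun α β hαβ => (summable_excess h β).tsum_le_tsum (fun x => by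
    have := wt_nonneg a x
    gcongr) (summable_excess h α)

/-- The variance-like quantity `∑ b(y) (|y| - E|y|)²`. -/
def lengthVar (b : PMF Γ) : ℝ := ∑' y, wt b y * (dist y 1 - meanLength b) ^ 2

lemma lengthVar_nonneg (b : PMF Γ) : 0 ≤ lengthVar b :=
  tsum_nonneg fun y => mul_nonneg (wt_nonneg b y) (sq_nonneg _)

/-- The mass of the complement of the ball of radius `R`. -/
def tail (a : PMF Γ) (R : ℝ) : ℝ := ∑' x, wt a x * (if R < dist x 1 then 1 else 0)

lemma summable_tail (a : PMF Γ) (R : ℝ) :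
    Summable fun x => wt a x * (if R < dist x 1 then (1 : ℝ) else 0) :=
  summable_wt_mul_of_abs_le a (C := 1) fun x => by split_ifs <;> simp

lemma tail_antitone (a : PMF Γ) : Antitone (tail a) := fun R R' h =>
  (summable_tail a R').tsum_le_tsum (fun x => by
    refine mul_le_mul_of_nonneg_left ?_ (wt_nonneg a x)
    split_ifs with h1 h2
    · exact le_rfl
    · exact absurd (h.trans_lt h1) h2
    · exact zero_le_one
    · exact le_rfl) (summable_tail a R)

lemma tail_nonneg (a : PMF Γ) (R : ℝ) : 0 ≤ tail a R :=
  tsum_nonneg fun x => mul_nonneg (wt_nonneg a x) (by split_ifs <;> simp)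

/-- One-sided Chebyshev inequality. -/
lemma tail_le_excess_div {a : PMF Γ} (h : FiniteSecondMoment a) {α R : ℝ} (hR : α < R) :
    tail a R ≤ excess a α / (R - α) ^ 2 := by
  have hs := (summable_excess h α).div_const ((R - α) ^ 2)
  rw [excess, ← tsum_div_const]
  refine (summable_tail a R).tsum_le_tsum (fun x => ?_) hs
  rw [mul_div_assoc]
  refine mul_le_mul_of_nonneg_left ?_ (wt_nonneg a x)
  have h0 : 0 < R - α := sub_pos.2 hR
  split_ifs with hx
  · rw [one_le_div (by positivity)]
    have : R - α ≤ max (dist x 1 - α) 0 := le_max_of_le_left (by linarith)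
    gcongr
  · positivity

variable [IsIsometricSMul Γ Γ]

lemma FiniteSecondMoment.mulConv {a b : PMF Γ} (ha : FiniteSecondMoment a)
    (hb : FiniteSecondMoment b) : FiniteSecondMoment (mulConv a b) := by
  have h := (mulConv_tsum_le_add a b (F := fun x => dist x 1 ^ 2)
    (G := fun x => dist x 1 ^ 2 * 2) (H := fun x => dist x 1 ^ 2 * 2) (fun x => sq_nonneg _)
    (fun x y _ _ => ?_) ?_ ?_).1
  · exact h.congr fun x => mul_comm _ _
  · have h1 := dist_mul_one_le x y
    have h2 : (0 : ℝ) ≤ dist (x * y) 1 := dist_nonneg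
    nlinarith [sq_nonneg (dist x 1 - dist y 1)]
  · simpa only [mul_assoc] using ha.summable.mul_right 2
  · simpa only [mul_assoc] using hb.summable.mul_right 2

lemma FiniteSecondMoment.convPow {μ : PMF Γ} (h : FiniteSecondMoment μ) (n : ℕ) :
    FiniteSecondMoment (convPow μ n) := by
  induction n with
  | zero =>
    exact (hasSum_wt_pure_one fun x : Γ => dist x 1 ^ 2).summable.congr fun x => mul_comm _ _
  | succ n ih => exact ih.mulConv h

lemma meanLength_mulConv_le {a b : PMF Γ} (ha : Summable fun x => wt a x * dist x 1)
    (hb : Summable fun x => wt b x * dist x 1) :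
    (Summable fun x => wt (mulConv a b) x * dist x 1) ∧
      meanLength (mulConv a b) ≤ meanLength a + meanLength b :=
  mulConv_tsum_le_add a b (fun _ => dist_nonneg) (fun x y _ _ => dist_mul_one_le x y) ha hb

lemma subadditive_meanLength {μ : PMF Γ} (h : FiniteSecondMoment μ) :
    Subadditive fun n => meanLength (convPow μ n) := fun m n => by
  simp only [convPow_add]
  exact (meanLength_mulConv_le (h.convPow m).summable_dist (h.convPow n).summable_dist).2

/-- The drift of the walk. -/
def drift {μ : PMF Γ} (h : FiniteSecondMoment μ) : ℝ := (subadditive_meanLength h).lim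

lemma tendsto_drift {μ : PMF Γ} (h : FiniteSecondMoment μ) :
    Tendsto (fun n : ℕ => meanLength (convPow μ n) / n) atTop (𝓝 (drift h)) :=
  (subadditive_meanLength h).tendsto_lim (bddBelow_meanLength_div μ)

lemma drift_nonneg {μ : PMF Γ} (h : FiniteSecondMoment μ) : 0 ≤ drift h :=
  ge_of_tendsto' (tendsto_drift h) fun n => div_nonneg (meanLength_nonneg _) n.cast_nonneg

lemma mul_drift_le {μ : PMF Γ} (h : FiniteSecondMoment μ) (n : ℕ) :
    n * drift h ≤ meanLength (convPow μ n) := by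
  rcases eq_or_ne n 0 with rfl | hn
  · simpa using meanLength_nonneg _
  · have := (subadditive_meanLength h).lim_le_div (bddBelow_meanLength_div μ) hn
    rw [le_div_iff₀ (by positivity)] at this
    rw [mul_comm]
    exact this

lemma isDrift_drift {μ : PMF Γ} (h : FiniteSecondMoment μ) : IsDrift μ (drift h) := by
  refine ⟨fun n => (h.convPow n).summable_dist.congr fun x => mul_comm _ _, ?_⟩
  refine (tendsto_drift h).congr fun n => ?_
  rw [meanLength]
  congr 1
  exact tsum_congr fun x => mul_comm _ _

lemma drift_le_meanLength {μ : PMF Γ} (h : FiniteSecondMoment μ) : drift h ≤ meanLength μ := by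
  simpa [convPow_one] using mul_drift_le h 1

/-! ### Concentration of the length -/

/-- Put Z = (|x|-α)₊ and W = |y| - E|y|. By the triangle inequality (|xy| - α - E|y|)₊² ≤ (Z+W)²,
and the cross term has mean zero because W is centred and independent of Z. Hence only variances add
up, and the excess grows linearly in the number of factors. -/
lemma excess_mulConv_le {a b : PMF Γ} (ha : FiniteSecondMoment a) (hb : FiniteSecondMoment b)
    (α : ℝ) : excess (mulConv a b) (α + meanLength b) ≤ excess a α + lengthVar b := by
  set β := meanLength b with hβ
  refine (mulConv_tsum_le a b (F := fun x => max (dist x 1 - (α + β)) 0 ^ 2)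
    (Φ := fun p => max (dist p.1 1 - α) 0 ^ 2
      + 2 * (max (dist p.1 1 - α) 0 * (dist p.2 1 - β)) + (dist p.2 1 - β) ^ 2)
    (fun x => sq_nonneg _) (fun x y _ _ => ?_) ?_).2
  · have h1 := dist_mul_one_le x y
    have h2 : dist x 1 - α ≤ max (dist x 1 - α) 0 := le_max_left _ _
    simp only
    rcases le_total (dist (x * y) 1 - (α + β)) 0 with h | h
    · rw [max_eq_right h]
      nlinarith [sq_nonneg (max (dist x 1 - α) 0 + (dist y 1 - β))]
    · rw [max_eq_left h]
      have h3 : dist (x * y) 1 - (α + β) ≤ max (dist x 1 - α) 0 + (dist y 1 - β) := by linarith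
      nlinarith
  · have h1 := hasSum_mul_prod (summable_excess ha α).hasSum (hasSum_wt b)
    have h2 := hasSum_mul_prod (hasSum_wt a) (summable_sq_sub hb β).hasSum
    have hZ : Summable fun x => wt a x * max (dist x 1 - α) 0 := by
      refine (summable_wt_mul_of_le a (G := fun x => 1 + max (dist x 1 - α) 0 ^ 2)
        (fun x => le_max_right _ _)
        (fun x _ => by nlinarith [sq_nonneg (max (dist x 1 - α) 0 - 1)]) ?_).1
      simpa only [mul_add, mul_one] using (summable_wt a).add (summable_excess ha α)
    have hW : HasSum (fun y => wt b y * (dist y 1 - β)) 0 := by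
      have h := hb.summable_dist.hasSum.sub ((hasSum_wt b).mul_right β)
      rw [one_mul, ← meanLength, ← hβ, sub_self] at h
      simpa only [mul_sub] using h
    have h3 := (hasSum_mul_prod hZ.hasSum hW).mul_left 2
    have h := (h1.add h3).add h2
    rw [mul_zero, mul_zero, add_zero, mul_one, one_mul] at h
    convert h using 1
    · funext p
      ring
    · rfl

lemma excess_convPow_le {b : PMF Γ} (hb : FiniteSecondMoment b) (k : ℕ) :
    excess (convPow b k) (k * meanLength b) ≤ k * lengthVar b := by
  induction k with
  | zero =>
    have : excess (convPow b 0) 0 = _ :=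
      (hasSum_wt_pure_one fun x : Γ => max (dist x 1 - 0) 0 ^ 2).tsum_eq
    simp [this]
  | succ k ih =>
    have h := excess_mulConv_le (hb.convPow k) hb (k * meanLength b)
    rw [convPow_succ]
    push_cast
    rw [add_mul, add_mul, one_mul, one_mul]
    linarith

/-- Weak law of large numbers for the length, uniformly in the time up to `n`. -/
lemma exists_tail_convPow_le {μ : PMF Γ} (h : FiniteSecondMoment μ) {ε η : ℝ} (hε : 0 < ε)
    (hη : 0 < η) :
    ∃ n₀ : ℕ, ∀ n ≥ n₀, ∀ k ≤ n, tail (convPow μ k) ((drift h + ε) * n) ≤ η := by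
  -- Time is cut into blocks of length m whose mean length is nearly mℓ. For k = mq + r the leftover
  -- block of length r < m is bounded through the sums C and V' over all r < m.
  obtain ⟨m, hm1, hm⟩ : ∃ m : ℕ, 1 ≤ m ∧ meanLength (convPow μ m) / m < drift h + ε / 2 :=
    ((eventually_ge_atTop 1).and
      ((tendsto_drift h).eventually_lt_const (by linarith : drift h < drift h + ε / 2))).exists
  have hm0 : (0 : ℝ) < m := by exact_mod_cast hm1
  rw [div_lt_iff₀ hm0] at hm
  set C := ∑ r ∈ Finset.range m, meanLength (convPow μ r) with hC
  set V' := ∑ r ∈ Finset.range m, lengthVar (convPow μ r) with hV'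
  set V := lengthVar (convPow μ m) with hV
  have hC0 : 0 ≤ C := Finset.sum_nonneg fun r _ => meanLength_nonneg _
  have hV'0 : 0 ≤ V' := Finset.sum_nonneg fun r _ => lengthVar_nonneg _
  have hV0 : 0 ≤ V := lengthVar_nonneg _
  have hℓ := drift_nonneg h
  -- The bound 4C/ε leaves a gap of at least nε/4 above the mean; the last one makes Chebyshev's
  -- n(V+V')/(nε/4)² at most η.
  obtain ⟨n₀, hn₀⟩ := exists_nat_gt (max (max 1 (4 * C / ε)) (16 * (V + V') / (ε ^ 2 * η)))
  refine ⟨n₀, fun n hn k hk => ?_⟩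
  have hn' : (n₀ : ℝ) ≤ n := by exact_mod_cast hn
  have hn1 : (1 : ℝ) < n :=
    ((le_max_left _ _).trans (le_max_left _ _)).trans_lt (hn₀.trans_le hn')
  have hnC : 4 * C / ε < n :=
    ((le_max_right _ _).trans (le_max_left _ _)).trans_lt (hn₀.trans_le hn')
  have hnV : 16 * (V + V') / (ε ^ 2 * η) < n := (le_max_right _ _).trans_lt (hn₀.trans_le hn')
  rw [div_lt_iff₀ hε] at hnC
  rw [div_lt_iff₀ (by positivity)] at hnV
  set q := k / m with hq
  set r := k % m with hr
  have hkqr : m * q + r = k := Nat.div_add_mod k m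
  have hrm : r ∈ Finset.range m := Finset.mem_range.2 (Nat.mod_lt _ hm1)
  have hqk : (m : ℝ) * q ≤ n := by
    have : m * q ≤ n := by omega
    exact_mod_cast this
  have hqn : (q : ℝ) ≤ n := by
    have : q ≤ n := (Nat.div_le_self k m).trans hk
    exact_mod_cast this
  have hfk : FiniteSecondMoment (convPow μ k) := h.convPow k
  have hex : excess (convPow μ k) (q * meanLength (convPow μ m) + meanLength (convPow μ r))
      ≤ q * V + lengthVar (convPow μ r) := by
    have h1 := excess_mulConv_le ((h.convPow m).convPow q) (h.convPow r)
      (q * meanLength (convPow μ m))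
    have h2 := excess_convPow_le (h.convPow m) q
    rw [← convPow_mul, ← convPow_add, hkqr] at h1
    rw [← convPow_mul] at h2
    linarith
  have hCr : meanLength (convPow μ r) ≤ C :=
    Finset.single_le_sum (f := fun r => meanLength (convPow μ r))
      (fun r _ => meanLength_nonneg _) hrm
  have hVr : lengthVar (convPow μ r) ≤ V' :=
    Finset.single_le_sum (f := fun r => lengthVar (convPow μ r))
      (fun r _ => lengthVar_nonneg _) hrm
  have hα : q * meanLength (convPow μ m) + meanLength (convPow μ r)
      ≤ (drift h + ε / 2) * n + C := by
    have : (q : ℝ) * meanLength (convPow μ m) ≤ q * ((drift h + ε / 2) * m) := by gcongr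
    nlinarith
  have hgap : n * ε / 4 ≤ (drift h + ε) * n - ((drift h + ε / 2) * n + C) := by nlinarith
  have hpos : 0 < n * ε / 4 := by positivity
  have hE : excess (convPow μ k) ((drift h + ε / 2) * n + C) ≤ n * (V + V') := by
    refine (excess_antitone hfk hα).trans (hex.trans ?_)
    nlinarith
  refine (tail_le_excess_div hfk (α := (drift h + ε / 2) * n + C) (by linarith)).trans ?_
  have hE0 : 0 ≤ n * (V + V') := by positivity
  refine (div_le_div₀ hE0 hE (by positivity) (pow_le_pow_left₀ hpos.le hgap 2)).trans ?_
  rw [div_le_iff₀ (by positivity)]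
  have : n * (V + V') * 16 ≤ n * (n * (ε ^ 2 * η)) := by nlinarith
  nlinarith

end Moments

/-! ### Volume growth -/

section Growth

variable {Γ : Type*} [Group Γ] [MetricSpace Γ]

/-- The number of elements of the ball of radius `R` around the identity. -/
def ballCard (Γ : Type*) [Group Γ] [MetricSpace Γ] (R : ℝ) : ℝ :=
  ((Metric.closedBall (1 : Γ) R).ncard : ℝ)

lemma one_le_ballCard (hproper : ProperDist Γ) {R : ℝ} (hR : 0 ≤ R) : 1 ≤ ballCard Γ R := by
  have : 0 < (Metric.closedBall (1 : Γ) R).ncard :=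
    (Set.ncard_pos (hproper R)).2 ⟨1, Metric.mem_closedBall_self hR⟩
  rw [ballCard]
  exact_mod_cast this

lemma volumeGrowth_nonneg (hproper : ProperDist Γ) {v : ℝ}
    (hv : volumeGrowth Γ = (v : EReal)) : 0 ≤ v := by
  have : (0 : EReal) ≤ volumeGrowth Γ := by
    refine le_liminf_of_le (by isBoundedDefault) (Eventually.of_forall fun n => ?_)
    have h := Real.log_nonneg (one_le_ballCard hproper (n.cast_nonneg : (0 : ℝ) ≤ n))
    exact EReal.coe_nonneg.2 (div_nonneg h n.cast_nonneg)
  rw [hv] at this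
  exact EReal.coe_nonneg.1 this

lemma frequently_log_ballCard_le {v δ : ℝ} (hv : volumeGrowth Γ = (v : EReal)) (hδ : 0 < δ) :
    ∃ᶠ N : ℕ in atTop, Real.log (ballCard Γ N) ≤ (v + δ) * N := by
  have h : volumeGrowth Γ < ((v + δ : ℝ) : EReal) := by
    rw [hv]
    exact EReal.coe_lt_coe_iff.2 (by linarith)
  have h1 := frequently_lt_of_liminf_lt (by isBoundedDefault) h
  refine (h1.and_eventually (eventually_ge_atTop 1)).mono fun N hN => ?_
  have hN0 : (0 : ℝ) < N := by exact_mod_cast hN.2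
  have := EReal.coe_lt_coe_iff.1 hN.1
  rw [div_lt_iff₀ hN0] at this
  exact this.le

/-- Arbitrarily large times `n` at which the ball of radius about `c n` is not too large. -/
lemma exists_time_radius {v c δ : ℝ} (hv : volumeGrowth Γ = (v : EReal)) (hc : 0 < c)
    (hδ : 0 < δ) (n₀ : ℕ) :
    ∃ n ≥ n₀, ∃ N : ℕ, c * n ≤ N ∧ (N : ℝ) ≤ c * (n + 1) ∧
      Real.log (ballCard Γ N) ≤ (v + δ) * N := by
  obtain ⟨N, hN, hNn⟩ := ((frequently_log_ballCard_le hv hδ).and_eventually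
    (tendsto_natCast_atTop_atTop.eventually_ge_atTop (c * n₀))).exists
  have hNc : 0 ≤ (N : ℝ) / c := by positivity
  -- As v is only a liminf, good radii N come first and the time is fitted to them.
  refine ⟨⌊(N : ℝ) / c⌋₊, Nat.le_floor ?_, N, ?_, ?_, hN⟩
  · rw [le_div_iff₀ hc]; linarith
  · have := Nat.floor_le hNc
    rw [le_div_iff₀ hc] at this
    linarith
  · have := (Nat.lt_floor_add_one ((N : ℝ) / c)).le
    rw [div_le_iff₀ hc] at this
    linarith

end Growth

/-! ### Entropy -/

section Entropy

/-- The tangent inequality for the entropy function. -/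
lemma negMulLog_le_tangent {q c : ℝ} (hq : 0 ≤ q) (hc : 0 < c) :
    Real.negMulLog q ≤ q * -Real.log c + (c - q) := by
  rcases hq.eq_or_lt with rfl | hq
  · simp [hc.le]
  · have h := Real.log_le_sub_one_of_pos (div_pos hc hq)
    rw [Real.log_div hc.ne' hq.ne'] at h
    have := mul_le_mul_of_nonneg_left h hq.le
    have e : q * (c / q - 1) = c - q := by field_simp
    rw [Real.negMulLog]
    linarith

/-- The entropy carried by a finite set. -/
lemma sum_negMulLog_wt_le {α : Type*} (a : PMF α) {s : Finset α} (hs : s.Nonempty) :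
    ∑ x ∈ s, Real.negMulLog (wt a x) ≤ Real.log s.card + 1 := by
  have hcard : (0 : ℝ) < s.card := by exact_mod_cast hs.card_pos
  have h1 : ∑ x ∈ s, wt a x ≤ 1 :=
    sum_le_hasSum s (fun x _ => wt_nonneg a x) (hasSum_wt a)
  have h0 : 0 ≤ ∑ x ∈ s, wt a x := Finset.sum_nonneg fun x _ => wt_nonneg a x
  have hlog : 0 ≤ Real.log s.card := Real.log_nonneg (by exact_mod_cast hs.card_pos)
  calc ∑ x ∈ s, Real.negMulLog (wt a x)
      ≤ ∑ x ∈ s, (wt a x * -Real.log ((s.card : ℝ)⁻¹) + ((s.card : ℝ)⁻¹ - wt a x)) :=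
        Finset.sum_le_sum fun x _ => negMulLog_le_tangent (wt_nonneg a x) (inv_pos.2 hcard)
    _ = (∑ x ∈ s, wt a x) * Real.log s.card + (1 - ∑ x ∈ s, wt a x) := by
        rw [Finset.sum_add_distrib, Finset.sum_sub_distrib, ← Finset.sum_mul, Real.log_inv,
          neg_neg, Finset.sum_const, nsmul_eq_mul, mul_inv_cancel₀ hcard.ne']
    _ ≤ Real.log s.card + 1 := by nlinarith

/-- The expected excess of the information function `-log a` over `K`. -/
def infoExcess {α : Type*} (a : PMF α) (K : ℝ) : ℝ :=
  ∑' x, wt a x * max (-Real.log (wt a x) - K) 0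

/-- The entropy of a probability mass function. -/
def entropy {α : Type*} (a : PMF α) : ℝ := ∑' x, Real.negMulLog (wt a x)

lemma wt_mul_max_neg_log {α : Type*} (a : PMF α) (x : α) :
    wt a x * max (-Real.log (wt a x) - 0) 0 = Real.negMulLog (wt a x) := by
  rw [sub_zero, max_eq_left, Real.negMulLog]
  · ring
  · exact neg_nonneg.2 (Real.log_nonpos (wt_nonneg a x) (wt_le_one a x))

lemma infoExcess_zero {α : Type*} (a : PMF α) : infoExcess a 0 = entropy a :=
  tsum_congr (wt_mul_max_neg_log a)

lemma summable_infoExcess {α : Type*} {a : PMF α} (ha : FiniteEntropy a) {K : ℝ} (hK : 0 ≤ K) :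
    Summable fun x => wt a x * max (-Real.log (wt a x) - K) 0 := by
  have ha' : Summable fun x => wt a x * max (-Real.log (wt a x) - 0) 0 :=
    ha.congr fun x => (wt_mul_max_neg_log a x).symm
  exact (summable_wt_mul_of_le a (fun x => le_max_right _ _)
    (fun x _ => max_le_max (by linarith) le_rfl) ha').1

lemma tendsto_infoExcess {α : Type*} {a : PMF α} (ha : FiniteEntropy a) :
    Tendsto (fun K : ℕ => infoExcess a K) atTop (𝓝 0) := by
  have h : Tendsto (fun K : ℕ => ∑' x, wt a x * max (-Real.log (wt a x) - K) 0) atTop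
      (𝓝 (∑' _ : α, (0 : ℝ))) := by
    refine tendsto_tsum_of_dominated_convergence (bound := fun x => Real.negMulLog (wt a x))
      ha (fun x => ?_) (Eventually.of_forall fun K x => ?_)
    · refine tendsto_const_nhds.congr' ?_
      filter_upwards [tendsto_natCast_atTop_atTop.eventually_ge_atTop (-Real.log (wt a x))]
        with K hK
      rw [max_eq_right (by linarith), mul_zero]
    · have hn : 0 ≤ wt a x * max (-Real.log (wt a x) - K) 0 :=
        mul_nonneg (wt_nonneg a x) (le_max_right _ _)
      rw [Real.norm_eq_abs, abs_of_nonneg hn, ← wt_mul_max_neg_log]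
      refine mul_le_mul_of_nonneg_left (max_le_max ?_ le_rfl) (wt_nonneg a x)
      have : (0 : ℝ) ≤ K := K.cast_nonneg
      linarith
  rwa [tsum_zero] at h

lemma entropy_nonneg {α : Type*} (a : PMF α) : 0 ≤ entropy a :=
  tsum_nonneg fun x => Real.negMulLog_nonneg (wt_nonneg a x) (wt_le_one a x)

variable {Γ : Type*} [Group Γ]

/-- Both -log along products and the positive part are subadditive. The case K = L = 0 is
subadditivity of entropy; for large K the lemma controls, uniformly per step, the entropy carried by
very unlikely points, with no bound on the growth of all balls. -/
lemma infoExcess_mulConv_le {a b : PMF Γ} (ha : FiniteEntropy a) (hb : FiniteEntropy b)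
    {K L : ℝ} (hK : 0 ≤ K) (hL : 0 ≤ L) :
    (Summable fun x => wt (mulConv a b) x *
      max (-Real.log (wt (mulConv a b) x) - (K + L)) 0) ∧
      infoExcess (mulConv a b) (K + L) ≤ infoExcess a K + infoExcess b L := by
  refine mulConv_tsum_le_add a b
    (F := fun x => max (-Real.log (wt (mulConv a b) x) - (K + L)) 0)
    (G := fun x => max (-Real.log (wt a x) - K) 0)
    (H := fun x => max (-Real.log (wt b x) - L) 0) (fun x => le_max_right _ _)
    (fun x y hx hy => ?_) (summable_infoExcess ha hK) (summable_infoExcess hb hL)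
  have h := Real.log_le_log (mul_pos hx hy) (mul_wt_le_wt_mulConv a b x y)
  rw [Real.log_mul hx.ne' hy.ne'] at h
  have h1 : -Real.log (wt a x) - K ≤ max (-Real.log (wt a x) - K) 0 := le_max_left _ _
  have h2 : -Real.log (wt b y) - L ≤ max (-Real.log (wt b y) - L) 0 := le_max_left _ _
  exact max_le (by linarith) (add_nonneg (le_max_right _ _) (le_max_right _ _))

lemma FiniteEntropy.mulConv {a b : PMF Γ} (ha : FiniteEntropy a) (hb : FiniteEntropy b) :
    FiniteEntropy (mulConv a b) := by
  have h := (infoExcess_mulConv_le ha hb le_rfl le_rfl).1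
  rw [add_zero] at h
  exact h.congr fun x => wt_mul_max_neg_log _ x

lemma entropy_mulConv_le {a b : PMF Γ} (ha : FiniteEntropy a) (hb : FiniteEntropy b) :
    entropy (RandomWalk.mulConv a b) ≤ entropy a + entropy b := by
  have h := (infoExcess_mulConv_le ha hb le_rfl le_rfl).2
  rwa [add_zero, infoExcess_zero, infoExcess_zero, infoExcess_zero] at h

lemma wt_pure_one_log (x : Γ) : Real.log (wt (PMF.pure (1 : Γ)) x) = 0 := by
  classical
  rw [wt_pure_one]
  split_ifs <;> simp

lemma FiniteEntropy.convPow {μ : PMF Γ} (h : FiniteEntropy μ) (n : ℕ) :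
    FiniteEntropy (convPow μ n) := by
  induction n with
  | zero =>
    refine summable_zero.congr fun x => ?_
    change 0 = Real.negMulLog (wt (PMF.pure (1 : Γ)) x)
    simp [Real.negMulLog, wt_pure_one_log]
  | succ n ih => exact ih.mulConv h

lemma infoExcess_convPow_le {μ : PMF Γ} (h : FiniteEntropy μ) {K : ℝ} (hK : 0 ≤ K) (n : ℕ) :
    infoExcess (convPow μ n) (n * K) ≤ n * infoExcess μ K := by
  induction n with
  | zero =>
    change infoExcess (PMF.pure (1 : Γ)) _ ≤ _
    simp [infoExcess, wt_pure_one_log]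
  | succ n ih =>
    have := (infoExcess_mulConv_le (h.convPow n) h (K := n * K) (by positivity) hK).2
    rw [← convPow_succ] at this
    push_cast
    rw [add_mul, add_mul, one_mul, one_mul]
    linarith

lemma subadditive_entropy {μ : PMF Γ} (h : FiniteEntropy μ) :
    Subadditive fun n => entropy (convPow μ n) := fun m n => by
  simp only [convPow_add]
  exact entropy_mulConv_le (h.convPow m) (h.convPow n)

lemma bddBelow_entropy_div (μ : PMF Γ) :
    BddBelow (Set.range fun n : ℕ => entropy (convPow μ n) / n) :=
  ⟨0, by
    rintro _ ⟨n, rfl⟩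
    exact div_nonneg (entropy_nonneg _) n.cast_nonneg⟩

lemma isAsymptoticEntropy_lim {μ : PMF Γ} (h : FiniteEntropy μ) :
    IsAsymptoticEntropy μ (subadditive_entropy h).lim :=
  ⟨h.convPow, (subadditive_entropy h).tendsto_lim (bddBelow_entropy_div μ)⟩

variable [MetricSpace Γ]

/-- The entropy is controlled by the size of a ball, up to the contribution of its complement. -/
lemma entropy_le_log_ballCard (hproper : ProperDist Γ) {a : PMF Γ} (ha : FiniteEntropy a)
    {R K : ℝ} (hR : 0 ≤ R) (hK : 0 ≤ K) :
    entropy a ≤ Real.log (ballCard Γ R) + 1 + K * tail a R + infoExcess a K := by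
  classical
  set s : Finset Γ := (hproper R).toFinset with hs
  have hmem : ∀ x, x ∈ s ↔ dist x 1 ≤ R := fun x => by
    rw [hs, Set.Finite.mem_toFinset, Metric.mem_closedBall]
  have hne : s.Nonempty := ⟨1, by rw [hmem, dist_self]; exact hR⟩
  have hcard : ballCard Γ R = s.card := by
    rw [ballCard, Set.ncard_eq_toFinset_card _ (hproper R)]
  have h1 : HasSum (fun x => if x ∈ s then Real.negMulLog (wt a x) else 0)
      (∑ x ∈ s, Real.negMulLog (wt a x)) := by
    have : ∑ x ∈ s, Real.negMulLog (wt a x) =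
        ∑ x ∈ s, if x ∈ s then Real.negMulLog (wt a x) else 0 :=
      Finset.sum_congr rfl fun x hx => (if_pos hx).symm
    rw [this]
    exact hasSum_sum_of_ne_finset_zero fun x hx => if_neg hx
  have h := (h1.add ((summable_tail a R).hasSum.mul_left K)).add
    (summable_infoExcess ha hK).hasSum
  have hle : entropy a ≤ ∑ x ∈ s, Real.negMulLog (wt a x) + K * tail a R + infoExcess a K := by
    refine hasSum_le (fun x => ?_) ha.hasSum h
    change Real.negMulLog (wt a x) ≤ _
    have h0 : 0 ≤ wt a x * max (-Real.log (wt a x) - K) 0 :=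
      mul_nonneg (wt_nonneg a x) (le_max_right _ _)
    have h2 := mul_le_mul_of_nonneg_left (le_max_left (-Real.log (wt a x) - K) 0)
      (wt_nonneg a x)
    by_cases hx : dist x 1 ≤ R
    · rw [if_pos ((hmem x).2 hx), if_neg (not_lt.2 hx)]
      linarith
    -- Off the ball, -log a is at most K plus its excess over K.
    · rw [if_neg (fun h => hx ((hmem x).1 h)), if_pos (not_le.1 hx), Real.negMulLog]
      linarith
  rw [hcard]
  linarith [sum_negMulLog_wt_le a hne]

/-- The fundamental inequality: entropy is at most drift times volume growth. -/
lemma asymptoticEntropy_le_drift_mul [IsIsometricSMul Γ Γ] (hproper : ProperDist Γ) {v : ℝ}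
    (hv : volumeGrowth Γ = (v : EReal)) {μ : PMF Γ} (hmom : FiniteSecondMoment μ)
    (hent : FiniteEntropy μ) : (subadditive_entropy hent).lim ≤ drift hmom * v := by
  set h := (subadditive_entropy hent).lim
  set ℓ := drift hmom
  have hℓ : 0 ≤ ℓ := drift_nonneg hmom
  have hv0 : 0 ≤ v := volumeGrowth_nonneg hproper hv
  have key : ∀ ε > 0, h ≤ (v + ε) * (ℓ + ε) * (1 + ε) + 3 * ε := by
    intro ε hε
    -- K is fixed before the tail tolerance ε/(K+1), so that the cutoff nK for the information at
    -- time n costs at most nε outside the ball. The three errors nε are the additive 1, this cost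
    -- and the excess over nK.
    obtain ⟨K, hK⟩ := ((tendsto_infoExcess hent).eventually_le_const hε).exists
    obtain ⟨n₁, hn₁⟩ := exists_tail_convPow_le hmom hε (div_pos hε (Nat.cast_add_one_pos K))
    obtain ⟨n₂, hn₂⟩ := exists_nat_gt (1 / ε)
    obtain ⟨n, hn, N, hN1, hN2, hN3⟩ := exists_time_radius hv (add_pos_of_nonneg_of_pos hℓ hε) hε
      (max n₁ (max n₂ 1))
    have hn0 : n ≠ 0 := by
      have := (le_max_right n₂ 1).trans ((le_max_right n₁ _).trans hn)
      omega
    have hnpos : (0 : ℝ) < n := by positivity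
    have hn1 : 1 ≤ n * ε := by
      have h1 : (n₂ : ℝ) ≤ n := by
        exact_mod_cast (le_max_left n₂ 1).trans ((le_max_right n₁ _).trans hn)
      rw [div_lt_iff₀ hε] at hn₂
      nlinarith
    have htail : (K : ℝ) * tail (convPow μ n) N ≤ ε := by
      have h1 : tail (convPow μ n) N ≤ ε / (K + 1) :=
        (tail_antitone _ hN1).trans (hn₁ n ((le_max_left _ _).trans hn) n le_rfl)
      have hK0 : (0 : ℝ) < K + 1 := Nat.cast_add_one_pos K
      rw [le_div_iff₀ hK0] at h1
      nlinarith [tail_nonneg (convPow μ n) (N : ℝ)]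
    have hH := entropy_le_log_ballCard hproper (hent.convPow n) (R := N) (K := n * K)
      (by positivity) (by positivity)
    have hI := infoExcess_convPow_le hent (K := K) (by positivity) n
    have hlim : h ≤ entropy (convPow μ n) / n :=
      (subadditive_entropy hent).lim_le_div (bddBelow_entropy_div μ) hn0
    refine hlim.trans ?_
    rw [div_le_iff₀ hnpos]
    have hB : Real.log (ballCard Γ N) ≤ (v + ε) * ((ℓ + ε) * (n + 1)) :=
      hN3.trans (mul_le_mul_of_nonneg_left hN2 (by positivity))
    have hB' : (v + ε) * ((ℓ + ε) * (n + 1)) ≤ (v + ε) * ((ℓ + ε) * (n * (1 + ε))) := by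
      have : 0 < ℓ + ε := by positivity
      gcongr
      linarith
    have h3 : (n : ℝ) * K * tail (convPow μ n) N ≤ n * ε := by
      rw [mul_assoc]
      gcongr
    have h4 : (n : ℝ) * infoExcess μ K ≤ n * ε := by gcongr
    linarith
  have hcont : Continuous fun ε : ℝ => (v + ε) * (ℓ + ε) * (1 + ε) + 3 * ε := by fun_prop
  have hlim : Tendsto (fun ε : ℝ => (v + ε) * (ℓ + ε) * (1 + ε) + 3 * ε) (𝓝[>] 0)
      (𝓝 (ℓ * v)) :=
    (hcont.tendsto' 0 _ (by ring)).mono_left nhdsWithin_le_nhds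
  exact ge_of_tendsto hlim (eventually_nhdsWithin_of_forall fun ε hε => key ε hε)

/-- Sum e^{-(C+1)(n+1)} over the ball of radius n+1 and then over n: level n contributes at most
e^{-(n+1)}, and each g is dominated by its level n = ⌊|g|⌋. -/
lemma summable_exp_neg_dist (hproper : ProperDist Γ) {C : ℝ} (hC : 0 ≤ C)
    (hgrowth : ∀ n : ℕ, 1 ≤ n → ballCard Γ n ≤ Real.exp (C * n)) :
    Summable fun g : Γ => Real.exp (-(C + 1) * (dist g 1 + 1)) := by
  classical
  have hS : Summable fun p : ℕ × Γ =>
      if dist p.2 1 ≤ (p.1 + 1 : ℕ) then Real.exp (-(C + 1) * (p.1 + 1 : ℕ)) else 0 := by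
    refine (summable_prod_of_nonneg fun p => ?_).2 ⟨fun n => ?_, ?_⟩
    · change (0 : ℝ) ≤ if _ then _ else _
      split_ifs
      · exact (Real.exp_pos _).le
      · exact le_rfl
    · refine summable_of_ne_finset_zero (s := (hproper (n + 1 : ℕ)).toFinset) fun g hg => if_neg ?_
      simpa using hg
    · refine Summable.of_nonneg_of_le (fun n => tsum_nonneg fun g => ?_) (fun n => ?_)
        (Real.summable_exp_neg_nat)
      · split_ifs
        · exact (Real.exp_pos _).le
        · exact le_rfl
      · rw [tsum_eq_sum (s := (hproper (n + 1 : ℕ)).toFinset) fun g hg => if_neg (by simpa using hg)]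
        have h1 : ∀ g ∈ (hproper (n + 1 : ℕ)).toFinset,
            (if dist g 1 ≤ (n + 1 : ℕ) then Real.exp (-(C + 1) * (n + 1 : ℕ)) else 0) ≤
              Real.exp (-(C + 1) * (n + 1 : ℕ)) := fun g _ => by
          split_ifs
          · exact le_rfl
          · exact (Real.exp_pos _).le
        refine (Finset.sum_le_card_nsmul _ _ _ h1).trans ?_
        have h2 := hgrowth (n + 1) (Nat.le_add_left 1 n)
        rw [ballCard, Set.ncard_eq_toFinset_card _ (hproper (n + 1 : ℕ))] at h2
        rw [nsmul_eq_mul]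
        calc _ ≤ Real.exp (C * (n + 1 : ℕ)) * Real.exp (-(C + 1) * (n + 1 : ℕ)) := by gcongr
          _ = Real.exp (-((n : ℝ) + 1)) := by
            rw [← Real.exp_add]
            push_cast
            ring_nf
          _ ≤ Real.exp (-n) := Real.exp_le_exp.2 (by linarith)
  have hswap := ((Equiv.prodComm Γ ℕ).summable_iff.2 hS).prod
  refine Summable.of_nonneg_of_le (fun g => (Real.exp_pos _).le) (fun g => ?_) hswap
  have hfac := ((Equiv.prodComm Γ ℕ).summable_iff.2 hS).prod_factor g
  refine le_trans ?_ (hfac.le_tsum ⌊dist g 1⌋₊ fun n _ => ?_)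
  · have h1 := Nat.lt_floor_add_one (dist g 1)
    have h2 := Nat.floor_le (dist_nonneg : 0 ≤ dist g 1)
    change _ ≤ if dist g 1 ≤ (⌊dist g 1⌋₊ + 1 : ℕ) then
      Real.exp (-(C + 1) * (⌊dist g 1⌋₊ + 1 : ℕ)) else 0
    rw [if_pos (by push_cast; exact h1.le)]
    apply Real.exp_le_exp.2
    push_cast
    nlinarith
  · change (0 : ℝ) ≤ if dist g 1 ≤ (n + 1 : ℕ) then Real.exp (-(C + 1) * (n + 1 : ℕ)) else 0
    split_ifs
    · exact (Real.exp_pos _).le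
    · exact le_rfl

/-- If balls grow at most exponentially, finite moments imply finite entropy. -/
lemma finiteEntropy_of_growth (hproper : ProperDist Γ) (hg : AtMostExponentialGrowth Γ)
    {μ : PMF Γ} (hmom : FiniteSecondMoment μ) : FiniteEntropy μ := by
  obtain ⟨C, hC⟩ := hg
  have hC' : ∀ n : ℕ, 1 ≤ n → ballCard Γ n ≤ Real.exp (max C 0 * n) := fun n hn =>
    (hC n hn).trans (Real.exp_le_exp.2
      (mul_le_mul_of_nonneg_right (le_max_left _ _) n.cast_nonneg))
  have hS := summable_exp_neg_dist hproper (le_max_right C 0) hC'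
  have h := ((hmom.summable_dist.add (summable_wt μ)).mul_left (max C 0 + 1)).add hS
  refine Summable.of_nonneg_of_le
    (fun x => Real.negMulLog_nonneg (wt_nonneg μ x) (wt_le_one μ x)) (fun x => ?_) h
  -- The reference weight is summable, and minus its logarithm is linear in |x|, hence integrable
  -- against μ.
  refine (negMulLog_le_tangent (wt_nonneg μ x)
    (Real.exp_pos (-(max C 0 + 1) * (dist x 1 + 1)))).trans ?_
  rw [Real.log_exp]
  have := wt_nonneg μ x
  linarith

end Entropy

/-! ### The walk at a geometric time -/

section GeometricTime

/-- The geometric law `j ↦ 2^{-(j+1)}` on `ℕ`. -/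
def geomLaw : PMF ℕ :=
  ⟨fun j => (2 : ENNReal)⁻¹ ^ (j + 1), by
    have h : ∑' j : ℕ, (2 : ENNReal)⁻¹ ^ (j + 1) = 1 := by
      rw [ENNReal.tsum_geometric_add_one, ENNReal.one_sub_inv_two, inv_inv,
        ENNReal.inv_mul_cancel two_ne_zero ENNReal.ofNat_ne_top]
    exact h ▸ ENNReal.summable.hasSum⟩

lemma geomLaw_apply (j : ℕ) : geomLaw j = (2 : ENNReal)⁻¹ ^ (j + 1) := rfl

lemma tsum_bind_mul {ι α : Type*} (b : PMF ι) (f : ι → PMF α) (G : α → ENNReal) :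
    ∑' x, b.bind f x * G x = ∑' j, b j * ∑' x, f j x * G x := by
  simp_rw [PMF.bind_apply, ← ENNReal.tsum_mul_right, ← ENNReal.tsum_mul_left]
  rw [ENNReal.tsum_comm]
  simp_rw [mul_assoc]

lemma tsum_mul_ofReal {α : Type*} (a : PMF α) {F : α → ℝ} (hF : ∀ x, 0 ≤ F x)
    (hs : Summable fun x => wt a x * F x) :
    ∑' x, a x * ENNReal.ofReal (F x) = ENNReal.ofReal (∑' x, wt a x * F x) := by
  rw [ENNReal.ofReal_tsum_of_nonneg (fun x => mul_nonneg (wt_nonneg a x) (hF x)) hs]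
  refine tsum_congr fun x => ?_
  rw [ENNReal.ofReal_mul (wt_nonneg a x), wt, ENNReal.ofReal_toReal (a.apply_ne_top x)]

lemma summable_of_tsum_ne_top {α : Type*} (a : PMF α) {F : α → ℝ} (hF : ∀ x, 0 ≤ F x)
    (h : ∑' x, a x * ENNReal.ofReal (F x) ≠ ⊤) : Summable fun x => wt a x * F x := by
  refine (ENNReal.summable_toReal h).congr fun x => ?_
  rw [ENNReal.toReal_mul, ENNReal.toReal_ofReal (hF x), wt]

variable {Γ : Type*} [Group Γ]

/-- The law of the walk at time `n` plus an independent geometric time. -/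
def delayed (μ : PMF Γ) (n : ℕ) : PMF Γ := geomLaw.bind fun j => convPow μ (n + j)

/-- The geometric time is 0 with probability 1/2, and otherwise is one more than a fresh copy of
itself. -/
lemma wt_delayed (μ : PMF Γ) (n : ℕ) (x : Γ) :
    wt (delayed μ n) x = (wt (convPow μ n) x + wt (delayed μ (n + 1)) x) / 2 := by
  have h : delayed μ n x = 2⁻¹ * (convPow μ n x + delayed μ (n + 1) x) := by
    have h1 : delayed μ n x = geomLaw 0 * convPow μ (n + 0) x +
        ∑' j, geomLaw (j + 1) * convPow μ (n + (j + 1)) x :=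
      (PMF.bind_apply _ _ _).trans (tsum_eq_zero_add' ENNReal.summable)
    have h2 : delayed μ (n + 1) x = ∑' j, geomLaw j * convPow μ (n + 1 + j) x :=
      PMF.bind_apply _ _ _
    rw [h1, h2, mul_add, ← ENNReal.tsum_mul_left, geomLaw_apply, zero_add, pow_one, add_zero]
    congr 1
    refine tsum_congr fun j => ?_
    rw [geomLaw_apply, geomLaw_apply, pow_succ' _ (j + 1), mul_assoc,
      show n + (j + 1) = n + 1 + j by ring]
  rw [wt, h, ENNReal.toReal_mul, ENNReal.toReal_add (PMF.apply_ne_top _ _)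
    (PMF.apply_ne_top _ _)]
  rw [ENNReal.toReal_inv, ENNReal.toReal_ofNat, inv_mul_eq_div]
  rfl

lemma mulConv_delayed (μ : PMF Γ) (n : ℕ) : mulConv (delayed μ n) μ = delayed μ (n + 1) := by
  rw [delayed, delayed, mulConv, PMF.bind_bind]
  congr 1
  funext j
  rw [show n + 1 + j = n + j + 1 by ring]
  rfl

lemma delayed_eq_mulConv (μ : PMF Γ) (n : ℕ) :
    delayed μ n = mulConv (convPow μ n) (delayed μ 0) := by
  simp only [delayed, mulConv, PMF.map_bind, zero_add]
  rw [PMF.bind_comm]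
  congr 1
  funext j
  exact convPow_add μ n j

variable [MetricSpace Γ]

lemma tail_le_meanLength_div {a : PMF Γ} (h : Summable fun x => wt a x * dist x 1) {R : ℝ}
    (hR : 0 < R) : tail a R ≤ meanLength a / R := by
  rw [meanLength, ← tsum_div_const]
  refine (summable_tail a R).tsum_le_tsum (fun x => ?_) (h.div_const R)
  rw [mul_div_assoc]
  refine mul_le_mul_of_nonneg_left ?_ (wt_nonneg a x)
  split_ifs with hx
  · rw [one_le_div hR]; exact hx.le
  · positivity

variable [IsIsometricSMul Γ Γ]

/-- The mean length at time j is at most j times that of one step, and j is integrable for the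
geometric law. Working in `ENNReal` permits exchanging the sums before finiteness is known. -/
lemma summable_dist_delayed {μ : PMF Γ} (h : FiniteSecondMoment μ) (n : ℕ) :
    Summable fun x => wt (delayed μ n) x * dist x 1 := by
  suffices h0 : Summable fun x => wt (delayed μ 0) x * dist x 1 by
    rw [delayed_eq_mulConv]
    exact (meanLength_mulConv_le (h.convPow n).summable_dist h0).1
  refine summable_of_tsum_ne_top _ (fun x => dist_nonneg) ?_
  rw [delayed, tsum_bind_mul]
  have hm : ∀ j : ℕ, meanLength (convPow μ j) ≤ j * meanLength μ := fun j => by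
    induction j with
    | zero =>
      have : meanLength (convPow μ 0) = _ := (hasSum_wt_pure_one fun x : Γ => dist x 1).tsum_eq
      simp [this]
    | succ j ih =>
      have := (meanLength_mulConv_le (h.convPow j).summable_dist h.summable_dist).2
      rw [← convPow_succ] at this
      push_cast
      linarith
  have hs : Summable fun j : ℕ => (1 / 2 : ℝ) ^ (j + 1) * (j * meanLength μ) := by
    have := (summable_pow_mul_geometric_of_norm_lt_one 1
      (by norm_num : ‖(1 / 2 : ℝ)‖ < 1)).mul_right (meanLength μ / 2)
    refine this.congr fun j => ?_
    ring
  refine ne_top_of_le_ne_top (ENNReal.ofReal_ne_top (r := ∑' j : ℕ, (1 / 2 : ℝ) ^ (j + 1) *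
    (j * meanLength μ))) ?_
  have hμ := meanLength_nonneg μ
  rw [ENNReal.ofReal_tsum_of_nonneg (fun j => by positivity) hs]
  refine ENNReal.tsum_le_tsum fun j => ?_
  rw [zero_add, tsum_mul_ofReal _ (fun x => dist_nonneg) (h.convPow j).summable_dist,
    ENNReal.ofReal_mul (by positivity), geomLaw_apply]
  refine mul_le_mul' (le_of_eq ?_) (ENNReal.ofReal_le_ofReal (hm j))
  rw [ENNReal.ofReal_pow (by norm_num), one_div, ENNReal.ofReal_inv_of_pos two_pos,
    ENNReal.ofReal_ofNat]

lemma mul_drift_le_delayed {μ : PMF Γ} (h : FiniteSecondMoment μ) (n : ℕ) :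
    n * drift h ≤ meanLength (delayed μ n) := by
  have h1 := tsum_mul_ofReal _ (fun x => dist_nonneg) (summable_dist_delayed h n)
  rw [← meanLength, delayed, tsum_bind_mul, ← delayed] at h1
  rw [← ENNReal.ofReal_le_ofReal_iff (meanLength_nonneg _), ← h1]
  calc ENNReal.ofReal (n * drift h) = ∑' j, geomLaw j * ENNReal.ofReal (n * drift h) := by
        rw [ENNReal.tsum_mul_right, geomLaw.tsum_coe, one_mul]
    _ ≤ _ := by
        refine ENNReal.tsum_le_tsum fun j => mul_le_mul' le_rfl ?_
        rw [tsum_mul_ofReal _ (fun x => dist_nonneg) (h.convPow (n + j)).summable_dist]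
        refine ENNReal.ofReal_le_ofReal (le_trans ?_ (mul_drift_le h (n + j)))
        have := drift_nonneg h
        push_cast
        gcongr
        simp

lemma tail_delayed_le (μ : PMF Γ) (n : ℕ) (R R' : ℝ) :
    tail (delayed μ n) (R + R') ≤ tail (convPow μ n) R + tail (delayed μ 0) R' := by
  rw [delayed_eq_mulConv]
  refine (mulConv_tsum_le_add _ _ (fun x => by split_ifs <;> simp) (fun x y _ _ => ?_)
    (summable_tail _ R) (summable_tail _ R')).2
  have := dist_mul_one_le x y
  split_ifs <;> norm_num
  linarith

end GeometricTime

/-! ### Summation by parts -/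

section Parts

variable {Γ : Type*} [Group Γ]

/-- The reversal `(x, γ) ↦ (xγ, γ⁻¹)` of edges. -/
def edgeFlip (Γ : Type*) [Group Γ] : Γ × Γ ≃ Γ × Γ where
  toFun p := (p.1 * p.2, p.2⁻¹)
  invFun p := (p.1 * p.2, p.2⁻¹)
  left_inv p := by simp
  right_inv p := by simp

/-- The shear `(x, γ) ↦ (xγ, γ)`. -/
def edgeShear (Γ : Type*) [Group Γ] : Γ × Γ ≃ Γ × Γ where
  toFun p := (p.1 * p.2, p.2)
  invFun p := (p.1 * p.2⁻¹, p.2)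
  left_inv p := by simp
  right_inv p := by simp

/-- Averages over edges of the two endpoint values. -/
lemma hasSum_edge {f F : Γ → ℝ} {s t : ℝ} (hf : HasSum f s) (hF : HasSum F t) :
    HasSum (fun p : Γ × Γ => f p.2 * ((F p.1 + F (p.1 * p.2)) / 2)) (s * t) := by
  have h1 : HasSum (fun p : Γ × Γ => f p.2 * F p.1) (s * t) := by
    have := hasSum_mul_prod hF hf
    rw [mul_comm] at this
    simpa only [mul_comm] using this
  have h2 : HasSum (fun p : Γ × Γ => f p.2 * F (p.1 * p.2)) (s * t) :=
    (edgeShear Γ).hasSum_iff.2 h1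
  have h := (h1.add h2).div_const 2
  rw [add_self_div_two] at h
  refine hasSum_of_eq h (fun p => ?_) rfl
  ring

/-- Counting measure times μ on edges is invariant under reversal because μ is symmetric; the
formula is the average of the sum and its reversal. This is where symmetry enters the drift bound.
-/
lemma hasSum_parts {μ : PMF Γ} (hsymm : IsSymmetric μ) {u F : Γ → ℝ} {s : ℝ}
    (h : HasSum (fun p : Γ × Γ => u p.1 * wt μ p.2 * (F (p.1 * p.2) - F p.1)) s) :
    HasSum (fun p : Γ × Γ =>
      wt μ p.2 * ((u p.1 - u (p.1 * p.2)) * (F (p.1 * p.2) - F p.1) / 2)) s := by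
  have h2 : HasSum (fun p : Γ × Γ =>
      u (p.1 * p.2) * wt μ p.2 * (F p.1 - F (p.1 * p.2))) s := by
    have := (edgeFlip Γ).hasSum_iff.2 h
    simpa [Function.comp_def, edgeFlip, hsymm.wt_inv] using this
  have h3 := (h.add h2).div_const 2
  rw [add_self_div_two] at h3
  refine hasSum_of_eq h3 (fun p => ?_) rfl
  ring

/-- The time average of the law of the walk, closed off by the delayed law. -/
def occupation (μ : PMF Γ) (n : ℕ) (x : Γ) : ℝ :=
  (∑ k ∈ Finset.range n, wt (convPow μ k) x + wt (delayed μ n) x) / (n + 1)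

lemma occupation_nonneg (μ : PMF Γ) (n : ℕ) (x : Γ) : 0 ≤ occupation μ n x :=
  div_nonneg (add_nonneg (Finset.sum_nonneg fun _ _ => wt_nonneg _ _) (wt_nonneg _ _))
    (by positivity)

/-- The purpose of the closing term: the law q_n that survives telescoping is dominated by n+1 times
the occupation density, so -log of that density costs q_n only its own information plus log(n+1). -/
lemma wt_delayed_le_occupation (μ : PMF Γ) (n : ℕ) (x : Γ) :
    wt (delayed μ n) x / (n + 1) ≤ occupation μ n x := by
  rw [occupation]
  gcongr
  exact le_add_of_nonneg_left (Finset.sum_nonneg fun _ _ => wt_nonneg _ _)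

lemma hasSum_occupation_mul (μ : PMF Γ) (n : ℕ) {F : Γ → ℝ}
    (hp : ∀ k, Summable fun x => wt (convPow μ k) x * F x)
    (hq : Summable fun x => wt (delayed μ n) x * F x) :
    HasSum (fun x => occupation μ n x * F x)
      ((∑ k ∈ Finset.range n, ∑' x, wt (convPow μ k) x * F x +
        ∑' x, wt (delayed μ n) x * F x) / (n + 1)) := by
  have h := ((hasSum_sum fun k (_ : k ∈ Finset.range n) => (hp k).hasSum).add
    hq.hasSum).div_const (n + 1 : ℝ)
  refine hasSum_of_eq h (fun x => ?_) rfl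
  rw [occupation, ← Finset.sum_mul]
  ring

lemma hasSum_occupation (μ : PMF Γ) (n : ℕ) : HasSum (occupation μ n) 1 := by
  have h := hasSum_occupation_mul μ n (F := fun _ => 1)
    (fun k => by simpa using summable_wt _) (by simpa using summable_wt _)
  simp only [mul_one, (hasSum_wt _).tsum_eq, Finset.sum_const, Finset.card_range,
    nsmul_eq_mul] at h
  rwa [div_self (by positivity)] at h

lemma occupation_le_one (μ : PMF Γ) (n : ℕ) (x : Γ) : occupation μ n x ≤ 1 :=
  le_hasSum (hasSum_occupation μ n) x fun y _ => occupation_nonneg μ n y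

variable [MetricSpace Γ]

lemma summable_wt_mul_of_linear {a : PMF Γ} (ha : Summable fun x => wt a x * dist x 1)
    {F : Γ → ℝ} {C : ℝ} (hF : ∀ x, |F x| ≤ C * (1 + dist x 1)) :
    Summable fun x => wt a x * F x := by
  refine Summable.of_norm_bounded (((summable_wt a).add ha).mul_left C) fun x => ?_
  rw [Real.norm_eq_abs, abs_mul, abs_of_nonneg (wt_nonneg a x)]
  calc wt a x * |F x| ≤ wt a x * (C * (1 + dist x 1)) :=
        mul_le_mul_of_nonneg_left (hF x) (wt_nonneg a x)
    _ = _ := by ring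

variable [IsIsometricSMul Γ Γ]

lemma hasSum_increment {a μ : PMF Γ} (ha : Summable fun x => wt a x * dist x 1)
    (hμ : Summable fun x => wt μ x * dist x 1) {F : Γ → ℝ} {C : ℝ} (hC : 0 ≤ C)
    (hF : ∀ x, |F x| ≤ C * (1 + dist x 1)) :
    HasSum (fun p : Γ × Γ => wt a p.1 * wt μ p.2 * (F (p.1 * p.2) - F p.1))
      (∑' x, wt (mulConv a μ) x * F x - ∑' x, wt a x * F x) := by
  have h1 : Summable fun p : Γ × Γ => wt a p.1 * wt μ p.2 * F (p.1 * p.2) := by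
    have hb := ((hasSum_mul_prod (hasSum_wt a) (hasSum_wt μ)).add
      ((hasSum_mul_prod ha.hasSum (hasSum_wt μ)).add
        (hasSum_mul_prod (hasSum_wt a) hμ.hasSum))).summable.mul_left C
    refine Summable.of_norm_bounded hb fun p => ?_
    have h0 : 0 ≤ wt a p.1 * wt μ p.2 := mul_nonneg (wt_nonneg _ _) (wt_nonneg _ _)
    rw [Real.norm_eq_abs, abs_mul, abs_of_nonneg h0]
    calc wt a p.1 * wt μ p.2 * |F (p.1 * p.2)|
        ≤ wt a p.1 * wt μ p.2 * (C * (1 + (dist p.1 1 + dist p.2 1))) := by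
          refine mul_le_mul_of_nonneg_left ((hF _).trans ?_) h0
          have := dist_mul_one_le p.1 p.2
          gcongr
      _ = _ := by ring
  have h2 := hasSum_mul_prod (summable_wt_mul_of_linear ha hF).hasSum (hasSum_wt μ)
  rw [mul_one] at h2
  rw [(hasSum_mulConv a μ h1.hasSum).tsum_eq]
  refine hasSum_of_eq (h1.hasSum.sub h2) (fun p => ?_) rfl
  ring

/-- The sum telescopes to p_n - δ_e + q_{n+1} - q_n, which equals q_n - δ_e since p_n + q_{n+1} =
2q_n. -/
lemma hasSum_increment_occupation {μ : PMF Γ} (h : FiniteSecondMoment μ) (n : ℕ)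
    {F : Γ → ℝ} {C : ℝ} (hC : 0 ≤ C) (hF : ∀ x, |F x| ≤ C * (1 + dist x 1)) :
    HasSum (fun p : Γ × Γ => occupation μ n p.1 * wt μ p.2 * (F (p.1 * p.2) - F p.1))
      ((∑' x, wt (delayed μ n) x * F x - F 1) / (n + 1)) := by
  have hk : ∀ k ∈ Finset.range n, HasSum
      (fun p : Γ × Γ => wt (convPow μ k) p.1 * wt μ p.2 * (F (p.1 * p.2) - F p.1))
      (∑' x, wt (convPow μ (k + 1)) x * F x - ∑' x, wt (convPow μ k) x * F x) := fun k _ =>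
    hasSum_increment (h.convPow k).summable_dist h.summable_dist hC hF
  have hq := hasSum_increment (summable_dist_delayed h n) h.summable_dist hC hF
  have hsum := ((hasSum_sum hk).add hq).div_const (n + 1 : ℝ)
  rw [Finset.sum_range_sub fun k => ∑' x, wt (convPow μ k) x * F x, mulConv_delayed] at hsum
  have h0 : ∑' x, wt (convPow μ 0) x * F x = F 1 := (hasSum_wt_pure_one F).tsum_eq
  have hd : ∑' x, wt (delayed μ n) x * F x =
      (∑' x, wt (convPow μ n) x * F x + ∑' x, wt (delayed μ (n + 1)) x * F x) / 2 := by
    rw [← (summable_wt_mul_of_linear (h.convPow n).summable_dist hF).tsum_add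
      (summable_wt_mul_of_linear (summable_dist_delayed h (n + 1)) hF), ← tsum_div_const]
    refine tsum_congr fun x => ?_
    rw [wt_delayed]
    ring
  refine hasSum_of_eq hsum (fun p => ?_) ?_
  · rw [occupation, ← Finset.sum_mul, ← Finset.sum_mul]
    ring
  · rw [h0]
    congr 1
    linarith

end Parts

/-! ### The drift inequality -/

section DriftBound

variable {Γ : Type*} [Group Γ]

/-- The information function of the occupation measure, truncated at `-log κ`. -/
def truncInfo (μ : PMF Γ) (n : ℕ) (κ : ℝ) (x : Γ) : ℝ := -Real.log (max (occupation μ n x) κ)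

/-- The total mass of the occupation measure truncated from above at `κ`. -/
def truncMass (μ : PMF Γ) (n : ℕ) (κ : ℝ) : ℝ := ∑' x, min (occupation μ n x) κ

lemma truncInfo_nonneg (μ : PMF Γ) (n : ℕ) {κ : ℝ} (hκ : 0 < κ) (hκ1 : κ ≤ 1) (x : Γ) :
    0 ≤ truncInfo μ n κ x :=
  neg_nonneg.2 (Real.log_nonpos (le_max_of_le_right hκ.le)
    (max_le (occupation_le_one μ n x) hκ1))

lemma truncInfo_le (μ : PMF Γ) (n : ℕ) {κ : ℝ} (hκ : 0 < κ) (x : Γ) :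
    truncInfo μ n κ x ≤ -Real.log κ :=
  neg_le_neg (Real.log_le_log hκ (le_max_right _ _))

lemma summable_truncMass (μ : PMF Γ) (n : ℕ) {κ : ℝ} (hκ : 0 < κ) :
    Summable fun x => min (occupation μ n x) κ :=
  Summable.of_nonneg_of_le (fun x => le_min (occupation_nonneg μ n x) hκ.le)
    (fun _ => min_le_left _ _) (hasSum_occupation μ n).summable

variable [MetricSpace Γ]

/-- The truncated cross entropy of the delayed law and the occupation measure. -/
lemma tsum_truncInfo_le (hproper : ProperDist Γ) (μ : PMF Γ) (n : ℕ) {κ R : ℝ} (hκ : 0 < κ)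
    (hκ1 : κ ≤ 1) (hR : 0 ≤ R) :
    ∑' x, wt (delayed μ n) x * truncInfo μ n κ x ≤
      Real.log (ballCard Γ R) + 1 + Real.log (n + 1) + -Real.log κ * tail (delayed μ n) R := by
  classical
  set a := delayed μ n
  set s : Finset Γ := (hproper R).toFinset with hs
  have hmem : ∀ x, x ∈ s ↔ dist x 1 ≤ R := fun x => by
    rw [hs, Set.Finite.mem_toFinset, Metric.mem_closedBall]
  have hne : s.Nonempty := ⟨1, by rw [hmem, dist_self]; exact hR⟩
  have hcard : ballCard Γ R = s.card := by
    rw [ballCard, Set.ncard_eq_toFinset_card _ (hproper R)]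
  have hn1 : (0 : ℝ) < n + 1 := by positivity
  have hln : 0 ≤ Real.log (n + 1) := Real.log_nonneg (by simp)
  have h1 : HasSum (fun x => if x ∈ s then Real.negMulLog (wt a x) else 0)
      (∑ x ∈ s, Real.negMulLog (wt a x)) := by
    have : ∑ x ∈ s, Real.negMulLog (wt a x) =
        ∑ x ∈ s, if x ∈ s then Real.negMulLog (wt a x) else 0 :=
      Finset.sum_congr rfl fun x hx => (if_pos hx).symm
    rw [this]
    exact hasSum_sum_of_ne_finset_zero fun x hx => if_neg hx
  have h := (h1.add ((hasSum_wt a).mul_right (Real.log (n + 1)))).add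
    ((summable_tail a R).hasSum.mul_left (-Real.log κ))
  have hlκ : 0 ≤ -Real.log κ := neg_nonneg.2 (Real.log_nonpos hκ.le hκ1)
  have hsum : Summable fun x => wt a x * truncInfo μ n κ x :=
    summable_wt_mul_of_abs_le a (C := -Real.log κ) fun x => by
      rw [abs_of_nonneg (truncInfo_nonneg μ n hκ hκ1 x)]
      exact truncInfo_le μ n hκ x
  have hle : ∑' x, wt a x * truncInfo μ n κ x ≤
      ∑ x ∈ s, Real.negMulLog (wt a x) + 1 * Real.log (n + 1) + -Real.log κ * tail a R := by
    refine hasSum_le (fun x => ?_) hsum.hasSum h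
    have hw0 := wt_nonneg a x
    by_cases hx : dist x 1 ≤ R
    · rw [if_pos ((hmem x).2 hx), if_neg (not_lt.2 hx), mul_zero, mul_zero, add_zero]
      rcases hw0.eq_or_lt with hw | hw
      · simp [← hw]
      · have h2 : Real.log (wt a x / (n + 1)) ≤ Real.log (max (occupation μ n x) κ) :=
          Real.log_le_log (div_pos hw hn1)
            ((wt_delayed_le_occupation μ n x).trans (le_max_left _ _))
        rw [Real.log_div hw.ne' hn1.ne'] at h2
        have h3 : truncInfo μ n κ x ≤ -Real.log (wt a x) + Real.log (n + 1) := by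
          rw [truncInfo]
          linarith
        have := mul_le_mul_of_nonneg_left h3 hw0
        rw [Real.negMulLog]
        linarith
    · rw [if_neg (fun h => hx ((hmem x).1 h)), if_pos (not_le.1 hx)]
      have := mul_le_mul_of_nonneg_left (truncInfo_le μ n hκ x) hw0
      have := mul_nonneg hw0 hln
      linarith
  rw [hcard]
  linarith [sum_negMulLog_wt_le a hne]

/-- Inside the ball the minimum is at most κ, outside at most the occupation density. The average
over k < n is why concentration must hold uniformly in time. -/
lemma truncMass_le (hproper : ProperDist Γ) (μ : PMF Γ) (n : ℕ) {κ R : ℝ} (hκ : 0 < κ) :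
    truncMass μ n κ ≤ κ * ballCard Γ R +
      (∑ k ∈ Finset.range n, tail (convPow μ k) R + tail (delayed μ n) R) / (n + 1) := by
  classical
  set s : Finset Γ := (hproper R).toFinset with hs
  have hmem : ∀ x, x ∈ s ↔ dist x 1 ≤ R := fun x => by
    rw [hs, Set.Finite.mem_toFinset, Metric.mem_closedBall]
  have hcard : ballCard Γ R = s.card := by
    rw [ballCard, Set.ncard_eq_toFinset_card _ (hproper R)]
  have h1 : HasSum (fun x => if x ∈ s then κ else 0) (κ * ballCard Γ R) := by
    have : κ * ballCard Γ R = ∑ x ∈ s, if x ∈ s then κ else 0 := by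
      rw [Finset.sum_congr rfl fun x hx => if_pos hx, Finset.sum_const, nsmul_eq_mul, hcard,
        mul_comm]
    rw [this]
    exact hasSum_sum_of_ne_finset_zero fun x hx => if_neg hx
  have h2 := hasSum_occupation_mul μ n (F := fun x => if R < dist x 1 then (1 : ℝ) else 0)
    (fun k => summable_tail _ R) (summable_tail _ R)
  refine hasSum_le (fun x => ?_) (summable_truncMass μ n hκ).hasSum (h1.add h2)
  by_cases hx : dist x 1 ≤ R
  · rw [if_pos ((hmem x).2 hx), if_neg (not_lt.2 hx), mul_zero, add_zero]
    exact min_le_right _ _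
  · rw [if_neg (fun h => hx ((hmem x).1 h)), if_pos (not_le.1 hx), mul_one, zero_add]
    exact min_le_left _ _

variable [IsIsometricSMul Γ Γ]

/-- `edge_production_truncated` for an edge of the group, weighted by its probability. -/
lemma weighted_edge_production (μ : PMF Γ) {u : Γ → ℝ} (hu : ∀ x, 0 ≤ u x)
    {M τ κ : ℝ} (hM : 0 < M) (hτ : 0 < τ) (hκ : 0 < κ) (x γ : Γ) :
    2 * (Real.sinh τ * Real.cosh τ + τ) / M *
        (wt μ γ * ((u x - u (x * γ)) * (dist (x * γ) 1 - dist x 1) / 2) -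
          wt μ γ * dist γ 1 * ((min (u x) κ + min (u (x * γ)) κ) / 2)) -
      wt μ γ * (Real.tanh τ * (Real.sinh τ * Real.cosh τ - τ) +
          Real.tanh τ * (Real.sinh τ * Real.cosh τ + τ) * (dist γ 1 / M) ^ 2) *
        ((u x + min (u x) κ + (u (x * γ) + min (u (x * γ)) κ)) / 2) ≤
      wt μ γ * ((u x - u (x * γ)) *
        (-Real.log (max (u (x * γ)) κ) - -Real.log (max (u x) κ)) / 2) := by
  have hedge := edge_production_truncated (hu x) (hu (x * γ)) hκ hτ hM
    (dist_nonneg : 0 ≤ dist γ 1)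
  have habs : (u x - u (x * γ)) * (dist (x * γ) 1 - dist x 1) ≤
      |u x - u (x * γ)| * dist γ 1 := by
    refine (le_abs_self _).trans ?_
    rw [abs_mul]
    exact mul_le_mul_of_nonneg_left (abs_dist_mul_sub_le x γ) (abs_nonneg _)
  have hw0 := wt_nonneg μ γ
  have hD : 0 ≤ 2 * (Real.sinh τ * Real.cosh τ + τ) / M := by
    have := le_sinh_mul_cosh hτ.le
    have : 0 < Real.sinh τ * Real.cosh τ + τ := by linarith
    positivity
  generalize 2 * (Real.sinh τ * Real.cosh τ + τ) / M = c at hedge hD ⊢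
  generalize Real.tanh τ * (Real.sinh τ * Real.cosh τ - τ) +
    Real.tanh τ * (Real.sinh τ * Real.cosh τ + τ) * (dist γ 1 / M) ^ 2 = e at hedge ⊢
  have h2 := mul_le_mul_of_nonneg_left habs hD
  have h3 : c * ((u x - u (x * γ)) * (dist (x * γ) 1 - dist x 1) / 2 -
      dist γ 1 * ((min (u x) κ + min (u (x * γ)) κ) / 2)) -
      e * ((u x + min (u x) κ + (u (x * γ) + min (u (x * γ)) κ)) / 2) ≤
      (u x - u (x * γ)) * (-Real.log (max (u (x * γ)) κ) - -Real.log (max (u x) κ)) / 2 := by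
    linarith
  have h4 := mul_le_mul_of_nonneg_left h3 hw0
  linarith

/-- The total entropy production of a density `u`, bounded below by its length production. -/
lemma production_lower_bound {μ : PMF Γ} (hmom : FiniteSecondMoment μ) (hM : 0 < M₂ μ)
    {u : Γ → ℝ} (hu : ∀ x, 0 ≤ u x) (hu1 : HasSum u 1) {τ κ σ d e : ℝ} (hτ : 0 < τ)
    (hκ : 0 < κ) (hσ : HasSum (fun x => min (u x) κ) σ)
    (hd : HasSum (fun p : Γ × Γ =>
      wt μ p.2 * ((u p.1 - u (p.1 * p.2)) * (dist (p.1 * p.2) 1 - dist p.1 1) / 2)) d)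
    (he : HasSum (fun p : Γ × Γ => wt μ p.2 * ((u p.1 - u (p.1 * p.2)) *
      (-Real.log (max (u (p.1 * p.2)) κ) - -Real.log (max (u p.1) κ)) / 2)) e) :
    2 * (Real.sinh τ * Real.cosh τ + τ) / M₂ μ * (d - meanLength μ * σ)
      - 2 * Real.tanh τ * (Real.sinh τ * Real.cosh τ) * (1 + σ) ≤ e := by
  have hr := hasSum_edge hmom.hasSum_dist hσ
  -- Since (|γ|/M₂)² has mean 1, the terms ∓τ cancel.
  have hw : HasSum (fun γ => wt μ γ * (Real.tanh τ * (Real.sinh τ * Real.cosh τ - τ) +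
      Real.tanh τ * (Real.sinh τ * Real.cosh τ + τ) * (dist γ 1 / M₂ μ) ^ 2))
      (2 * Real.tanh τ * (Real.sinh τ * Real.cosh τ)) := by
    have h := ((hasSum_wt μ).mul_right (Real.tanh τ * (Real.sinh τ * Real.cosh τ - τ))).add
      (((hasSum_M₂_sq hmom).div_const (M₂ μ ^ 2)).mul_left
        (Real.tanh τ * (Real.sinh τ * Real.cosh τ + τ)))
    refine hasSum_of_eq h (fun γ => ?_) ?_
    · rw [div_pow]; ring
    · rw [div_self (by positivity)]; ring
  have hw1 := hasSum_edge hw (hu1.add hσ)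
  have hlow := ((hd.sub hr).mul_left (2 * (Real.sinh τ * Real.cosh τ + τ) / M₂ μ)).sub hw1
  refine hasSum_le (fun p => ?_) hlow he
  exact weighted_edge_production μ hu hM hτ hκ p.1 p.2

/-- The drift is controlled by the truncated entropy production of the occupation measure. -/
lemma drift_le_production {μ : PMF Γ} (hsymm : IsSymmetric μ) (hmom : FiniteSecondMoment μ)
    (hM : 0 < M₂ μ) {τ κ : ℝ} (hτ : 0 < τ) (hκ : 0 < κ) (hκ1 : κ ≤ 1) (n : ℕ) :
    2 * (Real.sinh τ * Real.cosh τ + τ) / M₂ μ *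
        (n * drift hmom / (n + 1) - meanLength μ * truncMass μ n κ)
      - 2 * Real.tanh τ * (Real.sinh τ * Real.cosh τ) * (1 + truncMass μ n κ) ≤
      (∑' x, wt (delayed μ n) x * truncInfo μ n κ x) / (n + 1) := by
  have hd0 := hasSum_increment_occupation hmom n (F := fun x => dist x 1)
    (C := 1) zero_le_one fun x => by rw [abs_of_nonneg dist_nonneg]; linarith
  have hd := hasSum_parts hsymm (u := occupation μ n) (F := fun x => dist x 1) hd0
  have hlκ : 0 ≤ -Real.log κ := neg_nonneg.2 (Real.log_nonpos hκ.le hκ1)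
  -- The truncated information is bounded by -log κ, so no entropy hypothesis is needed.
  have he0 := hasSum_increment_occupation hmom n
    (F := truncInfo μ n κ) hlκ fun x => by
      rw [abs_of_nonneg (truncInfo_nonneg μ n hκ hκ1 x)]
      refine (truncInfo_le μ n hκ x).trans (le_mul_of_one_le_right hlκ ?_)
      linarith [(dist_nonneg : 0 ≤ dist x 1)]
  have he : HasSum (fun p : Γ × Γ => wt μ p.2 * ((occupation μ n p.1 -
      occupation μ n (p.1 * p.2)) * (-Real.log (max (occupation μ n (p.1 * p.2)) κ) -
        -Real.log (max (occupation μ n p.1) κ)) / 2)) _ :=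
    hasSum_parts hsymm (u := occupation μ n) (F := truncInfo μ n κ) he0
  have hmain := production_lower_bound hmom hM (occupation_nonneg μ n) (hasSum_occupation μ n)
    hτ hκ (summable_truncMass μ n hκ).hasSum hd he
  have h1 : n * drift hmom / (n + 1) ≤
      (∑' x, wt (delayed μ n) x * dist x 1 - dist (1 : Γ) 1) / (n + 1) := by
    rw [dist_self, sub_zero]
    exact div_le_div_of_nonneg_right (mul_drift_le_delayed hmom n) (by positivity)
  have h2 : (∑' x, wt (delayed μ n) x * truncInfo μ n κ x - truncInfo μ n κ 1) / (n + 1) ≤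
      (∑' x, wt (delayed μ n) x * truncInfo μ n κ x) / (n + 1) :=
    div_le_div_of_nonneg_right (by linarith [truncInfo_nonneg μ n hκ hκ1 (1 : Γ)])
      (by positivity)
  have hD : 0 ≤ 2 * (Real.sinh τ * Real.cosh τ + τ) / M₂ μ := by
    have := le_sinh_mul_cosh hτ.le
    have : 0 < Real.sinh τ * Real.cosh τ + τ := by linarith
    positivity
  refine le_trans ?_ (hmain.trans h2)
  exact sub_le_sub_right (mul_le_mul_of_nonneg_left (sub_le_sub_right h1 _) hD) _

/-- The limiting form of `drift_le_production`. -/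
lemma drift_inequality (hproper : ProperDist Γ) {v : ℝ} (hv : volumeGrowth Γ = (v : EReal))
    {μ : PMF Γ} (hsymm : IsSymmetric μ) (hmom : FiniteSecondMoment μ) (hM : 0 < M₂ μ)
    {τ : ℝ} (hτ : 0 < τ) :
    2 * (Real.sinh τ * Real.cosh τ + τ) / M₂ μ * drift hmom
      - 2 * Real.tanh τ * (Real.sinh τ * Real.cosh τ) ≤ v * drift hmom := by
  set c := 2 * (Real.sinh τ * Real.cosh τ + τ) / M₂ μ with hc
  set b := 2 * Real.tanh τ * (Real.sinh τ * Real.cosh τ) with hb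
  set ℓ := drift hmom
  set m := meanLength μ
  have hsc := le_sinh_mul_cosh hτ.le
  have hc0 : 0 ≤ c := by
    have : 0 < Real.sinh τ * Real.cosh τ + τ := by linarith
    positivity
  have hb0 : 0 ≤ b := by
    have := tanh_pos_of_pos hτ
    have : 0 ≤ Real.sinh τ * Real.cosh τ := by linarith
    positivity
  have hm0 : 0 ≤ m := meanLength_nonneg μ
  have hℓ : 0 ≤ ℓ := drift_nonneg hmom
  have hv0 : 0 ≤ v := volumeGrowth_nonneg hproper hv
  have key : ∀ ε ∈ Set.Ioo (0 : ℝ) 1,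
      c * ((1 - ε) * ℓ - m * (3 * ε)) - b * (1 + 3 * ε) ≤ (v + ε) * (ℓ + ε) + 4 * ε := by
    rintro ε ⟨hε, hε1⟩
    -- K - 1 bounds log #B(e,N)/n, because n + 1 ≤ 2n. With κ = e^{-Kn} this gives κ #B(e,N) ≤
    -- e^{-n}, while -log κ = Kn is still linear and is beaten by tails of size η with Kη ≤ ε.
    set K := 2 * ((v + 1) * (ℓ + 1)) + 1 with hK
    have hK0 : 0 < K := by positivity
    set η := ε / (K + 1) with hη
    have hη0 : 0 < η := by positivity
    have hηε : η ≤ ε := div_le_self hε.le (by linarith)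
    have hKη : K * η ≤ ε := by
      rw [hη, mul_div_assoc', div_le_iff₀ (by positivity)]
      nlinarith
    -- Only ε/2 is used here; the other (ε/2)n of the radius absorbs the geometric extra time, by
    -- Markov's inequality.
    obtain ⟨n₁, hn₁⟩ := exists_tail_convPow_le hmom (half_pos hε) hη0
    set m₀ := meanLength (delayed μ 0)
    have hlog : Tendsto (fun n : ℕ => Real.log ((n : ℝ) + 1) / ((n : ℝ) + 1)) atTop (𝓝 0) := by
      have h := (Real.tendsto_pow_log_div_mul_add_atTop 1 0 1 one_ne_zero).comp
        (tendsto_atTop_add_const_right atTop (1 : ℝ) (tendsto_natCast_atTop_atTop (R := ℝ)))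
      simpa [Function.comp_def] using h
    obtain ⟨n₂, hn₂⟩ := eventually_atTop.1 (hlog.eventually_le_const hε)
    obtain ⟨n₃, hn₃⟩ := exists_nat_gt (max (1 / ε) (m₀ / (η * (ε / 2))))
    obtain ⟨n, hn, N, hN1, hN2, hN3⟩ := exists_time_radius hv (add_pos_of_nonneg_of_pos hℓ hε) hε
      (max (max n₁ n₂) (max n₃ 1))
    have hnn₁ : n₁ ≤ n := (le_max_left _ _).trans ((le_max_left _ _).trans hn)
    have hnn₂ : n₂ ≤ n := (le_max_right _ _).trans ((le_max_left _ _).trans hn)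
    have hnn₃ : n₃ ≤ n := (le_max_left _ _).trans ((le_max_right _ _).trans hn)
    have hn1 : 1 ≤ n := (le_max_right _ _).trans ((le_max_right _ _).trans hn)
    have hn1' : (1 : ℝ) ≤ n := by exact_mod_cast hn1
    have hnpos : (0 : ℝ) < n := by linarith
    have hnn₃' : (n₃ : ℝ) ≤ n := by exact_mod_cast hnn₃
    have hnε : 1 ≤ n * ε := by
      have := (le_max_left _ _).trans_lt (hn₃.trans_le hnn₃')
      rw [div_lt_iff₀ hε] at this
      exact this.le
    have hnm : m₀ ≤ n * (η * (ε / 2)) := by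
      have := (le_max_right _ _).trans_lt (hn₃.trans_le hnn₃')
      rw [div_lt_iff₀ (by positivity)] at this
      exact this.le
    have htp : ∀ k ≤ n, tail (convPow μ k) ((ℓ + ε / 2) * n) ≤ η := hn₁ n hnn₁
    have htp' : ∀ k ≤ n, tail (convPow μ k) N ≤ η := fun k hk =>
      (tail_antitone _ (by have := mul_pos hε hnpos; linarith)).trans (htp k hk)
    have htq : tail (delayed μ n) N ≤ 2 * η := by
      have h1 := tail_delayed_le μ n ((ℓ + ε / 2) * n) (ε / 2 * n)
      have h2 : tail (delayed μ 0) (ε / 2 * n) ≤ η := by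
        refine (tail_le_meanLength_div (summable_dist_delayed hmom 0) (by positivity)).trans ?_
        rw [div_le_iff₀ (by positivity)]
        linarith
      have h3 := htp n le_rfl
      have h4 : tail (delayed μ n) N ≤ tail (delayed μ n) ((ℓ + ε / 2) * n + ε / 2 * n) :=
        tail_antitone _ (by linarith)
      linarith
    set κ := Real.exp (-(K * n)) with hκ
    have hκ0 : 0 < κ := Real.exp_pos _
    have hκ1 : κ ≤ 1 := Real.exp_le_one_iff.2 (by have := mul_pos hK0 hnpos; linarith)
    have hlogκ : -Real.log κ = K * n := by rw [hκ, Real.log_exp, neg_neg]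
    have hBpos : 0 < ballCard Γ (N : ℝ) :=
      zero_lt_one.trans_le (one_le_ballCard hproper N.cast_nonneg)
    have hlogB : Real.log (ballCard Γ N) ≤ (v + ε) * (ℓ + ε) * (n + 1) := by
      rw [mul_assoc]
      exact hN3.trans (mul_le_mul_of_nonneg_left hN2 (by positivity))
    have hκB : κ * ballCard Γ N ≤ ε := by
      have h1 : (v + ε) * (ℓ + ε) ≤ (v + 1) * (ℓ + 1) := by gcongr
      have h2 : (v + ε) * (ℓ + ε) * (n + 1) ≤ (K - 1) * n := by
        have : (v + ε) * (ℓ + ε) * (n + 1) ≤ (v + 1) * (ℓ + 1) * (2 * n) := by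
          gcongr
          linarith
        rw [hK]
        linarith
      rw [← Real.exp_log hBpos, hκ, ← Real.exp_add]
      have h3 : -(K * n) + Real.log (ballCard Γ N) ≤ -n := by linarith
      refine (Real.exp_le_exp.2 h3).trans ?_
      rw [Real.exp_neg, inv_le_comm₀ (Real.exp_pos _) hε]
      have h4 := Real.add_one_le_exp (n : ℝ)
      have h5 : ε⁻¹ ≤ n := by
        rw [inv_le_iff_one_le_mul₀ hε]
        exact hnε
      linarith
    have hn1pos : (0 : ℝ) < n + 1 := by positivity
    have hσ : truncMass μ n κ ≤ 3 * ε := by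
      refine (truncMass_le hproper μ n (R := N) hκ0).trans ?_
      have h1 : ∑ k ∈ Finset.range n, tail (convPow μ k) N ≤ n * η := by
        have := Finset.sum_le_card_nsmul (Finset.range n) (fun k => tail (convPow μ k) N) η
          fun k hk => htp' k (Finset.mem_range.1 hk).le
        simpa using this
      have h2 : (∑ k ∈ Finset.range n, tail (convPow μ k) N + tail (delayed μ n) N) / (n + 1)
          ≤ 2 * η := by
        rw [div_le_iff₀ hn1pos]
        have := mul_nonneg hnpos.le hη0.le
        linarith
      linarith
    have hprod := drift_le_production hsymm hmom hM hτ hκ0 hκ1 n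
    have hinfo := tsum_truncInfo_le hproper μ n hκ0 hκ1 (R := N) N.cast_nonneg
    have hup : (∑' x, wt (delayed μ n) x * truncInfo μ n κ x) / (n + 1) ≤
        (v + ε) * (ℓ + ε) + 4 * ε := by
      rw [div_le_iff₀ hn1pos]
      have h1 := hn₂ n hnn₂
      rw [div_le_iff₀ hn1pos] at h1
      have h2 : -Real.log κ * tail (delayed μ n) N ≤ 2 * ε * n := by
        rw [hlogκ]
        have h3 : K * n * tail (delayed μ n) N ≤ K * n * (2 * η) := by gcongr
        have h4 := mul_le_mul_of_nonneg_right hKη hnpos.le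
        linarith
      linarith
    have hℓn : (1 - ε) * ℓ ≤ n * ℓ / (n + 1) := by
      rw [le_div_iff₀ hn1pos]
      have h1 : (1 - ε) * (n + 1) ≤ n := by linarith
      have h2 := mul_le_mul_of_nonneg_right h1 hℓ
      linarith
    have hlow : c * ((1 - ε) * ℓ - m * (3 * ε)) ≤
        c * (n * ℓ / (n + 1) - m * truncMass μ n κ) := by
      have := mul_le_mul_of_nonneg_left hσ hm0
      exact mul_le_mul_of_nonneg_left (by linarith) hc0
    have hlow' : b * (1 + truncMass μ n κ) ≤ b * (1 + 3 * ε) :=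
      mul_le_mul_of_nonneg_left (by linarith) hb0
    linarith
  have hl : Tendsto (fun ε : ℝ => c * ((1 - ε) * ℓ - m * (3 * ε)) - b * (1 + 3 * ε)) (𝓝[>] 0)
      (𝓝 (c * ℓ - b)) :=
    (Continuous.tendsto' (by fun_prop) 0 _ (by ring)).mono_left nhdsWithin_le_nhds
  have hr : Tendsto (fun ε : ℝ => (v + ε) * (ℓ + ε) + 4 * ε) (𝓝[>] 0) (𝓝 (v * ℓ)) :=
    (Continuous.tendsto' (by fun_prop) 0 _ (by ring)).mono_left nhdsWithin_le_nhds
  exact le_of_tendsto_of_tendsto hl hr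
    (Filter.eventually_of_mem (Ioo_mem_nhdsGT one_pos) key)

/-- The drift, normalized by the second moment, is at most `tanh (M₂ v / 2)`. -/
lemma drift_div_le_tanh (hproper : ProperDist Γ) {v : ℝ} (hv : volumeGrowth Γ = (v : EReal))
    {μ : PMF Γ} (hsymm : IsSymmetric μ) (hmom : FiniteSecondMoment μ) :
    drift hmom / M₂ μ ≤ Real.tanh (M₂ μ * v / 2) := by
  have hv0 := volumeGrowth_nonneg hproper hv
  rcases (M₂_nonneg μ).eq_or_lt with hM | hM
  · simp [← hM]
  have key : ∀ τ > M₂ μ * v / 2, drift hmom / M₂ μ ≤ Real.tanh τ := by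
    intro τ hτ
    have hτ0 : 0 < τ := lt_of_le_of_lt (by positivity) hτ
    have h := drift_inequality hproper hv hsymm hmom hM hτ0
    have hℓ := drift_nonneg hmom
    have hsc : 0 < Real.sinh τ * Real.cosh τ := hτ0.trans_le (le_sinh_mul_cosh hτ0.le)
    set x := drift hmom / M₂ μ with hx
    have hx0 : 0 ≤ x := by positivity
    have hℓx : drift hmom = x * M₂ μ := by rw [hx]; field_simp
    have e : 2 * (Real.sinh τ * Real.cosh τ + τ) / M₂ μ * drift hmom =
        2 * (Real.sinh τ * Real.cosh τ + τ) * x := by rw [hx]; ring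
    rw [e, hℓx] at h
    -- As M₂v < 2τ, the terms 2τx cancel, leaving sinh τ cosh τ · x ≤ sinh τ cosh τ · tanh τ.
    have h2 : x * (M₂ μ * v) ≤ x * (2 * τ) := mul_le_mul_of_nonneg_left (by linarith) hx0
    have h3 : Real.sinh τ * Real.cosh τ * x ≤ Real.sinh τ * Real.cosh τ * Real.tanh τ := by
      linarith
    exact le_of_mul_le_mul_left h3 hsc
  exact ge_of_tendsto (continuous_tanh_real.continuousAt.tendsto.mono_left nhdsWithin_le_nhds)
    (eventually_nhdsWithin_of_forall (s := Set.Ioi (M₂ μ * v / 2)) key)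

/-- When M₂ = 0 the quotient ℓ/M₂ carries no information; in that case the mean length of a step
vanishes, and so does ℓ. -/
lemma drift_le_mul_tanh (hproper : ProperDist Γ) {v : ℝ} (hv : volumeGrowth Γ = (v : EReal))
    {μ : PMF Γ} (hsymm : IsSymmetric μ) (hmom : FiniteSecondMoment μ) :
    drift hmom ≤ M₂ μ * Real.tanh (M₂ μ * v / 2) := by
  rcases (M₂_nonneg μ).eq_or_lt with hM | hM
  · have h0 : M₂ μ = 0 := hM.symm
    have := drift_le_meanLength hmom
    rw [meanLength_eq_zero_of_M₂_eq_zero hmom h0] at this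
    simpa [h0] using this
  · have := drift_div_le_tanh hproper hv hsymm hmom
    rwa [div_le_iff₀ hM, mul_comm] at this

end DriftBound

/-! ### Spectral radius and quadratic forms -/

section Spectral

variable {Γ : Type*} [Group Γ]

lemma wt_mulConv_inv {a b : PMF Γ} (ha : IsSymmetric a) (hb : IsSymmetric b) (z : Γ) :
    wt (mulConv a b) z⁻¹ = wt (mulConv b a) z := by
  rw [wt_mulConv, wt_mulConv]
  refine Eq.trans (tsum_congr fun x => ?_) ((Equiv.mulLeft z).tsum_eq _)
  simp only [Equiv.coe_mulLeft]
  rw [mul_comm, ← hb.wt_inv (z * x), mul_inv_rev, inv_mul_cancel_right, ha.wt_inv]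

lemma IsSymmetric.convPow {μ : PMF Γ} (h : IsSymmetric μ) (n : ℕ) :
    IsSymmetric (convPow μ n) := by
  induction n with
  | zero =>
    intro g
    classical
    change PMF.pure (1 : Γ) g⁻¹ = PMF.pure (1 : Γ) g
    simp [PMF.pure_apply]
  | succ n ih =>
    intro g
    have h1 := wt_mulConv_inv ih h g
    rw [← convPow_succ] at h1
    have h2 : RandomWalk.mulConv μ (RandomWalk.convPow μ n) = RandomWalk.convPow μ (n + 1) := by
      rw [add_comm, convPow_add, convPow_one]
    rw [h2] at h1
    exact (ENNReal.toReal_eq_toReal_iff' (PMF.apply_ne_top _ _) (PMF.apply_ne_top _ _)).1 h1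

lemma hasSum_wt_mul_wt {a : PMF Γ} (ha : IsSymmetric a) (x y : Γ) :
    HasSum (fun z => wt a (x⁻¹ * z) * wt a (y⁻¹ * z)) (wt (mulConv a a) (x⁻¹ * y)) := by
  have h := (summable_wt_mulConv a a (x⁻¹ * y)).hasSum
  rw [← wt_mulConv] at h
  refine hasSum_of_eq ((Equiv.mulLeft x⁻¹).hasSum_iff.2 h) (fun z => ?_) rfl
  simp only [Function.comp, Equiv.coe_mulLeft]
  rw [← ha.wt_inv (y⁻¹ * z)]
  simp

/-- The weight at g is the inner product of a with a translate of itself, so 2zw ≤ z² + w² bounds it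
by the squared norm of a, the weight at the identity. -/
lemma wt_mulConv_self_le {a : PMF Γ} (ha : IsSymmetric a) (g : Γ) :
    wt (mulConv a a) g ≤ wt (mulConv a a) 1 := by
  have h1 := hasSum_wt_mul_wt ha 1 g
  have h2 := ((hasSum_wt_mul_wt ha 1 1).add (hasSum_wt_mul_wt ha g g)).div_const 2
  rw [inv_mul_cancel, inv_mul_cancel, add_self_div_two] at h2
  rw [inv_one, one_mul] at h1
  refine hasSum_le (fun z => ?_) h1 h2
  simp only [inv_one, one_mul]
  nlinarith [sq_nonneg (wt a z - wt a (g⁻¹ * z))]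

/-- The quadratic form `⟨f, P f⟩` of the convolution operator with law `a`, for a function
supported in the finite set `s`. -/
def quadForm (s : Finset Γ) (f : Γ → ℝ) (a : PMF Γ) : ℝ :=
  ∑ x ∈ s, ∑ y ∈ s, f x * f y * wt a (x⁻¹ * y)

/-- Cauchy–Schwarz, with ‖Pf‖² = ⟨f, P²f⟩ because P is self-adjoint. -/
lemma quadForm_sq_le (s : Finset Γ) (f : Γ → ℝ) {a : PMF Γ} (ha : IsSymmetric a) :
    quadForm s f a ^ 2 ≤ (∑ x ∈ s, f x ^ 2) * quadForm s f (mulConv a a) := by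
  set φ : Γ → ℝ := fun y => ∑ x ∈ s, f x * wt a (x⁻¹ * y) with hφ
  have h1 : quadForm s f a = ∑ y ∈ s, f y * φ y := by
    rw [quadForm, Finset.sum_comm]
    refine Finset.sum_congr rfl fun y _ => ?_
    rw [hφ, Finset.mul_sum]
    refine Finset.sum_congr rfl fun x _ => ?_
    ring
  have h2 : HasSum (fun y => φ y ^ 2) (quadForm s f (mulConv a a)) := by
    have h := hasSum_sum fun x (_ : x ∈ s) => hasSum_sum fun x' (_ : x' ∈ s) =>
      (hasSum_wt_mul_wt ha x x').mul_left (f x * f x')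
    refine hasSum_of_eq h (fun y => ?_) rfl
    rw [hφ, sq, Finset.sum_mul_sum]
    refine Finset.sum_congr rfl fun x _ => Finset.sum_congr rfl fun x' _ => ?_
    ring
  rw [h1]
  refine (Finset.sum_mul_sq_le_sq_mul_sq s f φ).trans ?_
  exact mul_le_mul_of_nonneg_left (sum_le_hasSum s (fun y _ => sq_nonneg _) h2)
    (Finset.sum_nonneg fun x _ => sq_nonneg _)

lemma quadForm_mulConv_self_le {s : Finset Γ} {f : Γ → ℝ} (hf : ∀ x, 0 ≤ f x) {a : PMF Γ}
    (ha : IsSymmetric a) :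
    quadForm s f (mulConv a a) ≤ (∑ x ∈ s, f x) ^ 2 * wt (mulConv a a) 1 := by
  rw [quadForm, sq, Finset.sum_mul_sum, Finset.sum_mul]
  refine Finset.sum_le_sum fun x _ => ?_
  rw [Finset.sum_mul]
  exact Finset.sum_le_sum fun y _ =>
    mul_le_mul_of_nonneg_left (wt_mulConv_self_le ha _) (mul_nonneg (hf x) (hf y))

lemma quadForm_nonneg {s : Finset Γ} {f : Γ → ℝ} (hf : ∀ x, 0 ≤ f x) (a : PMF Γ) :
    0 ≤ quadForm s f a :=
  Finset.sum_nonneg fun x _ => Finset.sum_nonneg fun y _ =>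
    mul_nonneg (mul_nonneg (hf x) (hf y)) (wt_nonneg a _)

/-- Iterating the Cauchy–Schwarz step doubles the power of P each time, which replaces the spectral
theorem. -/
lemma quadForm_pow_le {s : Finset Γ} {f : Γ → ℝ} (hf : ∀ x, 0 ≤ f x)
    (hF : 0 < ∑ x ∈ s, f x ^ 2) {μ : PMF Γ} (hsymm : IsSymmetric μ) (k : ℕ) :
    (∑ x ∈ s, f x ^ 2) * (quadForm s f μ / ∑ x ∈ s, f x ^ 2) ^ 2 ^ k ≤
      quadForm s f (convPow μ (2 ^ k)) := by
  induction k with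
  | zero =>
    rw [pow_zero, pow_one, convPow_one, mul_div_cancel₀ _ hF.ne']
  | succ k ih =>
    have h := quadForm_sq_le s f (hsymm.convPow (2 ^ k))
    rw [← convPow_add, ← two_mul, ← pow_succ'] at h
    have hA : 0 ≤ quadForm s f μ / ∑ x ∈ s, f x ^ 2 := div_nonneg (quadForm_nonneg hf μ) hF.le
    have h2 := pow_le_pow_left₀ (by positivity) ih 2
    have h3 := h2.trans h
    rw [mul_pow, sq, mul_assoc] at h3
    have h4 := le_of_mul_le_mul_left h3 hF
    rwa [← pow_mul, ← pow_succ] at h4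

/-- The Rayleigh quotient of a finitely supported function bounds the spectral radius. -/
lemma rayleigh_le_spectralRadius {s : Finset Γ} {f : Γ → ℝ} (hf : ∀ x, 0 ≤ f x)
    (hF : 0 < ∑ x ∈ s, f x ^ 2) {μ : PMF Γ} (hsymm : IsSymmetric μ) :
    quadForm s f μ / ∑ x ∈ s, f x ^ 2 ≤ spectralRadius μ := by
  set F := ∑ x ∈ s, f x ^ 2 with hFdef
  set A := quadForm s f μ / F with hA
  have hA0 : 0 ≤ A := div_nonneg (quadForm_nonneg hf μ) hF.le
  have hbdd : IsBoundedUnder (· ≤ ·) atTop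
      (fun n : ℕ => (convPow μ n 1).toReal ^ (1 / (n : ℝ))) :=
    isBoundedUnder_of ⟨1, fun n =>
      Real.rpow_le_one (wt_nonneg _ _) (wt_le_one _ _) (by positivity)⟩
  have hS : 0 < ∑ x ∈ s, f x := by
    refine (Finset.sum_nonneg fun x _ => hf x).lt_of_ne fun h => hF.ne' ?_
    have h0 := (Finset.sum_eq_zero_iff_of_nonneg fun x _ => hf x).1 h.symm
    exact Finset.sum_eq_zero fun x hx => by rw [h0 x hx]; simp
  refine le_of_forall_lt fun B hB => ?_
  obtain ⟨B', hBB', hB'A⟩ := exists_between hB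
  refine hBB'.trans_le (le_limsup_of_frequently_le ?_ hbdd)
  rcases lt_or_ge B' 0 with hneg | hB'0
  · exact Frequently.of_forall fun n => hneg.le.trans (Real.rpow_nonneg (wt_nonneg _ _) _)
  have hApos : 0 < A := hB'0.trans_lt hB'A
  -- Passing from B' to a larger A absorbs the constant ‖f‖²/(∑f)². Times 2^k suffice for a limsup.
  have hlim : Tendsto (fun k : ℕ => (B' / A) ^ 2 ^ k) atTop (𝓝 0) :=
    (tendsto_pow_atTop_nhds_zero_of_lt_one (by positivity) ((div_lt_one hApos).2 hB'A)).comp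
      (tendsto_pow_atTop_atTop_of_one_lt one_lt_two)
  have hev := hlim.eventually_le_const (show 0 < F / (∑ x ∈ s, f x) ^ 2 by positivity)
  have htend : Tendsto (fun k : ℕ => 2 ^ k) atTop atTop :=
    tendsto_pow_atTop_atTop_of_one_lt (one_lt_two : 1 < 2)
  refine htend.frequently (Eventually.frequently ?_)
  -- k ≥ 1 makes the time even, so that the return probability is the largest weight.
  filter_upwards [hev, eventually_ge_atTop 1] with k hk hk1
  have h1 := quadForm_pow_le hf hF hsymm k
  have h2 : quadForm s f (convPow μ (2 ^ k)) ≤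
      (∑ x ∈ s, f x) ^ 2 * wt (convPow μ (2 ^ k)) 1 := by
    obtain ⟨j, rfl⟩ := Nat.exists_eq_add_of_le' hk1
    rw [pow_succ' 2 j, two_mul, convPow_add]
    exact quadForm_mulConv_self_le hf (hsymm.convPow _)
  have h3 : B' ^ 2 ^ k ≤ wt (convPow μ (2 ^ k)) 1 := by
    rw [div_pow, div_le_div_iff₀ (by positivity) (by positivity)] at hk
    have h4 := (hk.trans h1).trans h2
    rw [mul_comm] at h4
    exact le_of_mul_le_mul_left h4 (by positivity)
  calc B' = (B' ^ 2 ^ k) ^ (1 / ((2 ^ k : ℕ) : ℝ)) := by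
        rw [one_div, Real.pow_rpow_inv_natCast hB'0 (by positivity)]
    _ ≤ _ := Real.rpow_le_rpow (by positivity) h3 (by positivity)

/-- The quadratic form as a sum over edges. -/
lemma hasSum_quadForm {s : Finset Γ} {f : Γ → ℝ} (hfs : ∀ x ∉ s, f x = 0) (μ : PMF Γ) :
    HasSum (fun p : Γ × Γ => wt μ p.2 * (f p.1 * f (p.1 * p.2))) (quadForm s f μ) := by
  have h : HasSum (fun p : Γ × Γ => f p.1 * f p.2 * wt μ (p.1⁻¹ * p.2)) (quadForm s f μ) := by
    rw [quadForm, ← Finset.sum_product' s s fun x y => f x * f y * wt μ (x⁻¹ * y)]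
    refine hasSum_sum_of_ne_finset_zero fun p hp => ?_
    rw [Finset.mem_product, not_and_or] at hp
    rcases hp with hp | hp <;> rw [hfs _ hp] <;> simp
  refine hasSum_of_eq ((((factorEquiv Γ).symm.trans (Equiv.prodComm Γ Γ))).hasSum_iff.2 h)
    (fun p => ?_) rfl
  change wt μ p.2 * (f p.1 * f (p.1 * p.2)) =
    f p.1 * f (p.1 * p.2) * wt μ (p.1⁻¹ * (p.1 * p.2))
  rw [inv_mul_cancel_left, mul_comm]

end Spectral

/-! ### The test function -/

section TestFunction

variable {Γ : Type*} [Group Γ] [MetricSpace Γ]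

/-- The test function `e^{t (n - |x|)}` on the ball of radius `n`. -/
def testFun (Γ : Type*) [Group Γ] [MetricSpace Γ] (t n : ℝ) (x : Γ) : ℝ :=
  if dist x 1 ≤ n then Real.exp (t * (n - dist x 1)) else 0

/-- The square of the test function near the boundary of the ball. -/
def testFunBoundary (Γ : Type*) [Group Γ] [MetricSpace Γ] (t n k : ℝ) (x : Γ) : ℝ :=
  if n - k < dist x 1 then testFun Γ t n x ^ 2 else 0

lemma testFun_nonneg (t n : ℝ) (x : Γ) : 0 ≤ testFun Γ t n x := by
  rw [testFun]
  split_ifs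
  · exact (Real.exp_pos _).le
  · exact le_rfl

lemma testFunBoundary_nonneg (t n k : ℝ) (x : Γ) : 0 ≤ testFunBoundary Γ t n k x := by
  rw [testFunBoundary]
  split_ifs
  · exact sq_nonneg _
  · exact le_rfl

lemma testFunBoundary_le {t n k : ℝ} (ht : 0 ≤ t) (x : Γ) :
    testFunBoundary Γ t n k x ≤ Real.exp (2 * t * k) := by
  rw [testFunBoundary, testFun]
  split_ifs with h1 h2
  · rw [← Real.exp_nat_mul]
    apply Real.exp_le_exp.2
    have : t * (n - dist x 1) ≤ t * k := mul_le_mul_of_nonneg_left (by linarith) ht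
    push_cast
    linarith
  · simpa using (Real.exp_pos _).le
  · exact (Real.exp_pos _).le

/-- The left side equals e^α e^β cosh(α-β). -/
lemma mul_exp_mul_cosh_ge {α β c : ℝ} (h : |α - β| ≤ c) :
    (Real.exp α ^ 2 + Real.exp β ^ 2) / 2 ≤ Real.exp α * Real.exp β * Real.cosh c := by
  have h1 : Real.cosh (α - β) ≤ Real.cosh c := by
    rw [Real.cosh_le_cosh]
    exact h.trans (le_abs_self c)
  refine le_trans (le_of_eq ?_)
    (mul_le_mul_of_nonneg_left h1 (mul_pos (Real.exp_pos α) (Real.exp_pos β)).le)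
  rw [Real.cosh_eq, neg_sub, Real.exp_sub, Real.exp_sub]
  have := Real.exp_pos α
  have := Real.exp_pos β
  field_simp

variable [IsIsometricSMul Γ Γ]

/-- Inside the ball log f varies by at most t|γ| along the edge. An edge leaving the ball has
product 0: if |γ| ≤ k its inner endpoint lies in the boundary layer, which pays for it; if |γ| > k
the correction |γ|²/k² forces S ≤ 0. -/
lemma testFun_edge {t n k S : ℝ} (ht : 0 ≤ t) (hk : 0 < k) (x γ : Γ)
    (hS : S ≤ 1 / Real.cosh (t * dist γ 1) - dist γ 1 ^ 2 / k ^ 2) :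
    (testFun Γ t n x ^ 2 + testFun Γ t n (x * γ) ^ 2) / 2 * S
      - (testFunBoundary Γ t n k x + testFunBoundary Γ t n k (x * γ)) / 2 ≤
      testFun Γ t n x * testFun Γ t n (x * γ) := by
  have hcosh := Real.cosh_pos (t * dist γ 1)
  have hcosh1 : 1 / Real.cosh (t * dist γ 1) ≤ 1 := (div_le_one hcosh).2 (Real.one_le_cosh _)
  have hg0 : 0 ≤ dist γ 1 ^ 2 / k ^ 2 := by positivity
  have hb := testFunBoundary_nonneg t n k x
  have hb' := testFunBoundary_nonneg t n k (x * γ)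
  have habs := abs_dist_mul_sub_le x γ
  have habs2 := abs_le.1 habs
  have hfar : k < dist γ 1 → S ≤ 0 := fun hlt => by
    have : 1 ≤ dist γ 1 ^ 2 / k ^ 2 := by
      rw [one_le_div (by positivity)]
      gcongr
    linarith
  by_cases hx : dist x 1 ≤ n <;> by_cases hx' : dist (x * γ) 1 ≤ n
  · have h1 : testFun Γ t n x = Real.exp (t * (n - dist x 1)) := if_pos hx
    have h2 : testFun Γ t n (x * γ) = Real.exp (t * (n - dist (x * γ) 1)) := if_pos hx'
    have h3 := mul_exp_mul_cosh_ge (α := t * (n - dist x 1)) (β := t * (n - dist (x * γ) 1))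
      (c := t * dist γ 1) (by
        rw [← mul_sub, abs_mul, abs_of_nonneg ht]
        refine mul_le_mul_of_nonneg_left ?_ ht
        rwa [sub_sub_sub_cancel_left])
    rw [← h1, ← h2] at h3
    have h4 : (testFun Γ t n x ^ 2 + testFun Γ t n (x * γ) ^ 2) / 2 * S ≤
        (testFun Γ t n x ^ 2 + testFun Γ t n (x * γ) ^ 2) / 2 *
          (1 / Real.cosh (t * dist γ 1)) :=
      mul_le_mul_of_nonneg_left (by linarith) (by positivity)
    rw [mul_one_div] at h4
    have h5 := (div_le_iff₀ hcosh).2 h3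
    linarith
  · have h2 : testFun Γ t n (x * γ) = 0 := if_neg hx'
    rw [h2, mul_zero, zero_pow two_ne_zero, add_zero]
    have hsq := sq_nonneg (testFun Γ t n x)
    rcases lt_or_ge k (dist γ 1) with hlt | hge
    · have := mul_nonpos_of_nonneg_of_nonpos hsq (hfar hlt)
      linarith
    · have h3 : testFunBoundary Γ t n k x = testFun Γ t n x ^ 2 := if_pos (by linarith)
      have : testFun Γ t n x ^ 2 / 2 * S ≤ testFun Γ t n x ^ 2 / 2 * 1 :=
        mul_le_mul_of_nonneg_left (by linarith) (by positivity)
      linarith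
  · have h2 : testFun Γ t n x = 0 := if_neg hx
    rw [h2, zero_mul, zero_pow two_ne_zero, zero_add]
    have hsq := sq_nonneg (testFun Γ t n (x * γ))
    rcases lt_or_ge k (dist γ 1) with hlt | hge
    · have := mul_nonpos_of_nonneg_of_nonpos hsq (hfar hlt)
      linarith
    · have h3 : testFunBoundary Γ t n k (x * γ) = testFun Γ t n (x * γ) ^ 2 :=
        if_pos (by linarith)
      have : testFun Γ t n (x * γ) ^ 2 / 2 * S ≤ testFun Γ t n (x * γ) ^ 2 / 2 * 1 :=
        mul_le_mul_of_nonneg_left (by linarith) (by positivity)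
      linarith
  · have h1 : testFun Γ t n x = 0 := if_neg hx
    have h2 : testFun Γ t n (x * γ) = 0 := if_neg hx'
    rw [h1, h2]
    linarith

/-- The Rayleigh quotient of the test function. -/
lemma spectralRadius_ge_testFun (hproper : ProperDist Γ) {μ : PMF Γ} (hsymm : IsSymmetric μ)
    (hmom : FiniteSecondMoment μ) {t k m : ℝ} (ht : 0 < t) (hk : 0 < k) (hm : M₂ μ < m)
    (n : ℕ) :
    1 / Real.cosh (t * m) - M₂ μ ^ 2 / k ^ 2
      - Real.exp (2 * t * k) * ballCard Γ n / Real.exp (2 * t * n) ≤ spectralRadius μ := by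
  classical
  set s : Finset Γ := (hproper n).toFinset with hs
  have hmem : ∀ x, x ∈ s ↔ dist x 1 ≤ n := fun x => by
    rw [hs, Set.Finite.mem_toFinset, Metric.mem_closedBall]
  have hcard : ballCard Γ n = s.card := by
    rw [ballCard, Set.ncard_eq_toFinset_card _ (hproper n)]
  have hfs : ∀ x ∉ s, testFun Γ t n x = 0 := fun x hx => if_neg fun h => hx ((hmem x).2 h)
  have hm0 : 0 < m := (M₂_nonneg μ).trans_lt hm
  have hF : HasSum (fun x => testFun Γ t n x ^ 2) (∑ x ∈ s, testFun Γ t n x ^ 2) :=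
    hasSum_sum_of_ne_finset_zero fun x hx => by rw [hfs x hx]; simp
  have hE : HasSum (fun x => testFunBoundary Γ t n k x) (∑ x ∈ s, testFunBoundary Γ t n k x) :=
    hasSum_sum_of_ne_finset_zero fun x hx => by
      rw [testFunBoundary, hfs x hx]
      simp
  have hF1 : Real.exp (2 * t * n) ≤ ∑ x ∈ s, testFun Γ t n x ^ 2 := by
    have h1 : (1 : Γ) ∈ s := by
      rw [hmem, dist_self]
      exact n.cast_nonneg
    refine le_trans (le_of_eq ?_)
      (Finset.single_le_sum (f := fun x => testFun Γ t n x ^ 2) (fun x _ => sq_nonneg _) h1)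
    have h2 : testFun Γ t n (1 : Γ) = Real.exp (t * (n - dist (1 : Γ) 1)) :=
      if_pos ((hmem 1).1 h1)
    simp only [h2, dist_self, sub_zero]
    rw [← Real.exp_nat_mul]
    push_cast
    ring_nf
  have hF0 : 0 < ∑ x ∈ s, testFun Γ t n x ^ 2 := (Real.exp_pos _).trans_le hF1
  have hE1 : ∑ x ∈ s, testFunBoundary Γ t n k x ≤ Real.exp (2 * t * k) * ballCard Γ n := by
    have := Finset.sum_le_card_nsmul s (fun x => testFunBoundary Γ t n k x) _
      fun x _ => testFunBoundary_le ht.le x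
    rwa [nsmul_eq_mul, ← hcard, mul_comm] at this
  -- -q is the slope of y ↦ 1/cosh(t√y) at y = m². Averaging the tangent line over μ gives the gain
  -- q(m² - M₂²) ≥ 0. Taking m > M₂ keeps the tangent point positive even if M₂ = 0.
  obtain ⟨q, hq0, hq⟩ : ∃ q : ℝ, 0 ≤ q ∧ ∀ g : ℝ, 0 ≤ g →
      1 / Real.cosh (t * m) - q * (g ^ 2 - m ^ 2) ≤ 1 / Real.cosh (t * g) := by
    refine ⟨Real.tanh (t * m) / (2 * (t * m) * Real.cosh (t * m)) * t ^ 2, ?_, fun g hg => ?_⟩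
    · have h1 := tanh_pos_of_pos (mul_pos ht hm0)
      have h2 := Real.cosh_pos (t * m)
      positivity
    · refine le_trans (le_of_eq ?_)
        (one_div_cosh_tangent (mul_nonneg ht.le hg) (mul_pos ht hm0))
      ring
  have hw : HasSum (fun γ => wt μ γ * (1 / Real.cosh (t * m) - q * (dist γ 1 ^ 2 - m ^ 2)
      - dist γ 1 ^ 2 / k ^ 2))
      (1 / Real.cosh (t * m) - q * (M₂ μ ^ 2 - m ^ 2) - M₂ μ ^ 2 / k ^ 2) := by
    have h := ((hasSum_wt μ).mul_right (1 / Real.cosh (t * m) + q * m ^ 2)).sub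
      ((hasSum_M₂_sq hmom).mul_right (q + 1 / k ^ 2))
    refine hasSum_of_eq h (fun γ => ?_) ?_ <;> ring
  have hlow := (hasSum_edge hw hF).sub (hasSum_edge (hasSum_wt μ) hE)
  have hle := hasSum_le (fun p => ?_) hlow (hasSum_quadForm hfs μ)
  · have hray := rayleigh_le_spectralRadius (testFun_nonneg t (n : ℝ)) hF0 hsymm
    refine le_trans ?_ hray
    rw [le_div_iff₀ hF0]
    refine le_trans ?_ hle
    have h1 : 0 ≤ q * (m ^ 2 - M₂ μ ^ 2) := by
      have := pow_le_pow_left₀ (M₂_nonneg μ) hm.le 2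
      exact mul_nonneg hq0 (by linarith)
    have h2 : Real.exp (2 * t * k) * ballCard Γ n ≤
        Real.exp (2 * t * k) * ballCard Γ n / Real.exp (2 * t * n) *
          ∑ x ∈ s, testFun Γ t n x ^ 2 := by
      rw [div_mul_eq_mul_div, le_div_iff₀ (Real.exp_pos _)]
      refine mul_le_mul_of_nonneg_left hF1 ?_
      rw [hcard]
      positivity
    have h3 := mul_nonneg h1 hF0.le
    linarith
  · have hwt := wt_nonneg μ p.2
    have h1 := testFun_edge (n := n) ht.le hk p.1 p.2
      (sub_le_sub_right (hq (dist p.2 1) dist_nonneg) (dist p.2 1 ^ 2 / k ^ 2))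
    have h2 := mul_le_mul_of_nonneg_left h1 hwt
    linarith

lemma one_div_cosh_le_spectralRadius_of_lt (hproper : ProperDist Γ) {v : ℝ}
    (hv : volumeGrowth Γ = (v : EReal)) {μ : PMF Γ} (hsymm : IsSymmetric μ)
    (hmom : FiniteSecondMoment μ) {t m : ℝ} (ht : v / 2 < t) (hm : M₂ μ < m) :
    1 / Real.cosh (t * m) ≤ spectralRadius μ := by
  have hv0 := volumeGrowth_nonneg hproper hv
  have ht0 : 0 < t := lt_of_le_of_lt (by positivity) ht
  refine le_of_forall_pos_le_add fun ε hε => ?_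
  have hklim : Tendsto (fun k : ℕ => M₂ μ ^ 2 / (k : ℝ) ^ 2) atTop (𝓝 0) :=
    tendsto_const_nhds.div_atTop
      ((tendsto_pow_atTop two_ne_zero).comp tendsto_natCast_atTop_atTop)
  obtain ⟨k, hk, hk1⟩ :=
    ((hklim.eventually_le_const (half_pos hε)).and (eventually_ge_atTop 1)).exists
  have hk0 : (0 : ℝ) < k := by exact_mod_cast hk1
  set δ := t - v / 2 with hδ
  have hδ0 : 0 < δ := sub_pos.2 ht
  have hnlim : Tendsto (fun n : ℕ => Real.exp (2 * t * k) * Real.exp (-(δ * n))) atTop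
      (𝓝 (Real.exp (2 * t * k) * 0)) :=
    (Real.tendsto_exp_neg_atTop_nhds_zero.comp
      (tendsto_natCast_atTop_atTop.const_mul_atTop hδ0)).const_mul _
  rw [mul_zero] at hnlim
  -- The layer width k is already fixed. Since 2t = v + 2δ, the squared peak e^{2tn} beats #B(e,n)
  -- by e^{δn} along the good radii, which kills the boundary term.
  obtain ⟨n, hn, hn'⟩ := ((frequently_log_ballCard_le hv hδ0).and_eventually
    (hnlim.eventually_le_const (half_pos hε))).exists
  have h := spectralRadius_ge_testFun hproper hsymm hmom ht0 hk0 hm n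
  have hB : 0 < ballCard Γ (n : ℝ) :=
    zero_lt_one.trans_le (one_le_ballCard hproper n.cast_nonneg)
  have h1 : ballCard Γ n / Real.exp (2 * t * n) ≤ Real.exp (-(δ * n)) := by
    rw [← Real.exp_log hB, ← Real.exp_sub]
    apply Real.exp_le_exp.2
    have e : 2 * t * n = (v + δ) * n + δ * n := by rw [hδ]; ring
    linarith
  have h2 : Real.exp (2 * t * k) * ballCard Γ n / Real.exp (2 * t * n) ≤ ε / 2 := by
    rw [mul_div_assoc]
    exact (mul_le_mul_of_nonneg_left h1 (Real.exp_pos _).le).trans hn'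
  linarith

/-- The lower bound for the spectral radius. -/
lemma one_div_cosh_le_spectralRadius (hproper : ProperDist Γ) {v : ℝ}
    (hv : volumeGrowth Γ = (v : EReal)) {μ : PMF Γ} (hsymm : IsSymmetric μ)
    (hmom : FiniteSecondMoment μ) :
    1 / Real.cosh (M₂ μ * v / 2) ≤ spectralRadius μ := by
  have hcont : Continuous fun ε : ℝ => 1 / Real.cosh ((v / 2 + ε) * (M₂ μ + ε)) :=
    continuous_const.div (Real.continuous_cosh.comp (by fun_prop)) fun ε => (Real.cosh_pos _).ne'
  have hlim : Tendsto (fun ε : ℝ => 1 / Real.cosh ((v / 2 + ε) * (M₂ μ + ε))) (𝓝[>] 0)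
      (𝓝 (1 / Real.cosh (M₂ μ * v / 2))) :=
    (hcont.tendsto' 0 _ (by ring_nf)).mono_left nhdsWithin_le_nhds
  refine le_of_tendsto hlim (eventually_nhdsWithin_of_forall fun ε hε => ?_)
  have hε' : 0 < ε := hε
  exact one_div_cosh_le_spectralRadius_of_lt hproper hv hsymm hmom (by linarith) (by linarith)

end TestFunction

end

end RandomWalk

theorem theorem1p1 {Γ : Type*} [Group Γ] [Countable Γ] [MetricSpace Γ]
    -- left invariance of the distance
    [IsIsometricSMul Γ Γ]
    (hproper : RandomWalk.ProperDist Γ)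
    (v : ℝ) (hv : RandomWalk.volumeGrowth Γ = (v : EReal))
    (μ : PMF Γ) (hsymm : RandomWalk.IsSymmetric μ)
    (hmom : RandomWalk.FiniteSecondMoment μ) :
    (∃ ℓ : ℝ, RandomWalk.IsDrift μ ℓ ∧
      ℓ / RandomWalk.M₂ μ ≤ Real.tanh (RandomWalk.M₂ μ * v / 2)) ∧
    (RandomWalk.FiniteEntropy μ ∨ RandomWalk.AtMostExponentialGrowth Γ →
      ∃ h : ℝ, RandomWalk.IsAsymptoticEntropy μ h ∧
        h ≤ RandomWalk.M₂ μ * v * Real.tanh (RandomWalk.M₂ μ * v / 2)) ∧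
    1 / Real.cosh (RandomWalk.M₂ μ * v / 2) ≤ RandomWalk.spectralRadius μ := by
  refine ⟨⟨RandomWalk.drift hmom, RandomWalk.isDrift_drift hmom,
    RandomWalk.drift_div_le_tanh hproper hv hsymm hmom⟩, fun hH => ?_,
    RandomWalk.one_div_cosh_le_spectralRadius hproper hv hsymm hmom⟩
  have hent : RandomWalk.FiniteEntropy μ :=
    hH.elim id fun hg => RandomWalk.finiteEntropy_of_growth hproper hg hmom
  refine ⟨_, RandomWalk.isAsymptoticEntropy_lim hent,
    (RandomWalk.asymptoticEntropy_le_drift_mul hproper hv hmom hent).trans ?_⟩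
  have h1 := mul_le_mul_of_nonneg_right (RandomWalk.drift_le_mul_tanh hproper hv hsymm hmom)
    (RandomWalk.volumeGrowth_nonneg hproper hv)
  linarith
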